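/- Let $\ell,T\in(0,\infty)$ and $\mathcal V=\{v\in H^2(0,\ell): v(0)=v_x(0)=0\}$ with the norm $\|v\|_{\mathcal V}^2=\int_0^\ell (v^2+v_x^2+v_{xx}^2)\,dx$. Let $\rho,\mu\in L^\infty(0,\ell)$, $r,\kappa\in H^2(0,\ell)$ and constants satisfy $$0<\rho_0\le\rho\le\rho_1,\qquad 0\le\mu_0\le\mu\le\mu_1,\qquad 0<r_0\le r\le r_1,\qquad 0<\kappa_0\le\kappa\le\kappa_1$$ a.e. on $(0,\ell)$. Let $g\in H^1(0,T)$ with $g(0)=0$, and $u_0,v_0\in\mathcal V$. Consider the damped cantilever problem $$\rho u_{tt}+\mu u_t+(r u_{xx})_{xx}+(\kappa u_{xxt})_{xx}=0\ \text{ on }(0,\ell)\times(0,T],\qquad u(\cdot,0)=u_0,\quad u_t(\cdot,0)=v_0,$$ $$u(0,t)=u_x(0,t)=0,\qquad [r u_{xx}+\kappa u_{xxt}]_{x=\ell}=0,\qquad -[(r u_{xx}+\kappa u_{xxt})_x]_{x=\ell}=g(t).$$ A weak solution is a function $u\in L^2(0,T;\mathcal V)$ with weak time derivatives $u_t\in L^2(0,T;\mathcal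 V)$ and $u_{tt}\in L^2(0,T;L^2(0,\ell))$ such that for every $v\in\mathcal V$ and a.e. $t\in[0,T]$ $$(\rho u_{tt}(t),v)+(\mu u_t(t),v)+(r u_{xx}(t),v_{xx})+(\kappa u_{xxt}(t),v_{xx})=g(t)\,v(\ell),$$ where $(\cdot,\cdot)$ is the $L^2(0,\ell)$ inner product, and $u(0)=u_0$, $u_t(0)=v_0$, the initial values being those of the continuous representatives $u\in C([0,T];\mathcal V)$, $u_t\in C([0,T];L^2(0,\ell))$. **Theorem.** There is exactly one weak solution $u$. With $$C^*=4\ell^2(1+4\ell^2)+1,\qquad C_0^2=e^T-1,$$ $$R=\frac{2(1+T)\ell^3}{3r_0}\|g'\|_{L^2(0,T)}^2+\rho_1\|v_0\|_{L^2(0,\ell)}^2+r_1\|u_{0,xx}\|_{L^2(0,\ell)}^2,$$ $$R_1(u_0,v_0)=\|v_0\|_{L^2(0,\ell)}^2+\|u_{0,xx}\|_{L^2(0,\ell)}^2+\|v_{0,xx}\|_{L^2(0,\ell)}^2,$$ $$A=\left(\frac{4r_1^2(\ell^3+3)}{3r_0}+\frac{\kappa_0\ell^3}{4(\ell^3+3)}+r_1\right)\frac{C_0^2+1}{\kappa_0},$$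 $$C_1^2=\max\left\{\frac{2A}{3r_0}+\frac{2(\ell^3+3)}{3\ell^3\kappa_0},\ A\rho_1+\mu_1,\ A r_1+r_1^2,\ \kappa_1+1\right\},$$ it satisfies $$\|u_{xx}\|^2_{L^\infty(0,T;L^2(0,\ell))}\le\frac{2(C_0^2+1)}{r_0}R,\qquad \|u\|^2_{L^2(0,T;\mathcal V)}\le\frac{2C^*C_0^2}{r_0}R,$$ $$\|u_t\|^2_{L^2(0,T;\mathcal V)}\le\frac{C^*(C_0^2+1)}{2\kappa_0}R,\qquad \|u_{tt}\|^2_{L^2(0,T;L^2(0,\ell))}\le\frac{C_1^2}{2\rho_0}\left[(1+T)\ell^3\|g'\|^2_{L^2(0,T)}+R_1(u_0,v_0)\right].$$ -/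

import Mathlib

open MeasureTheory Set
open scoped ContDiff ENNReal

noncomputable section

namespace KVBeam

/-- Lebesgue measure on the open interval `(a, b)`. -/
abbrev ivl (a b : ℝ) : Measure ℝ := volume.restrict (Ioo a b)

/-- The space `L²(0, ℓ)`. -/
abbrev L2 (ℓ : ℝ) : Type := Lp ℝ 2 (ivl 0 ℓ)

section Calculus

variable {E : Type*} [NormedAddCommGroup E] [NormedSpace ℝ E]

/-- `f'` is the weak (distributional) derivative of `f` on `(a, b)`:
`∫ φ' f = - ∫ φ f'` for all `φ ∈ C_c^∞(a, b)`. -/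
def HasWeakDeriv (a b : ℝ) (f f' : ℝ → E) : Prop :=
  ∀ φ : ℝ → ℝ, ContDiff ℝ ∞ φ → HasCompactSupport φ → tsupport φ ⊆ Ioo a b →
    ∫ x, deriv φ x • f x ∂(ivl a b) = - ∫ x, φ x • f' x ∂(ivl a b)

/-- `w` is a representative of `f`, continuous on `[a, b]`. -/
def IsContRep (a b : ℝ) (f w : ℝ → E) : Prop :=
  ContinuousOn w (Icc a b) ∧ f =ᵐ[ivl a b] w

/-- The continuous representative of `f` on `[a, b]` exists and takes the value `c` at `x`. -/
def HasValueAt (a b : ℝ) (f : ℝ → E) (x : ℝ) (c : E) : Prop :=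
  ∃ w : ℝ → E, IsContRep a b f w ∧ w x = c

theorem integrable_test_smul {a b : ℝ} {ψ : ℝ → ℝ} (hψ : Continuous ψ)
    (hc : HasCompactSupport ψ) {f : ℝ → E} (hf : MemLp f 2 (ivl a b)) :
    Integrable (fun x => ψ x • f x) (ivl a b) := by
  obtain ⟨C, hC⟩ := hc.exists_bound_of_continuous hψ
  have h1 : Integrable f (ivl a b) := hf.integrable (by norm_num)
  exact h1.bdd_smul C hψ.aestronglyMeasurable (Filter.Eventually.of_forall hC)

theorem HasWeakDeriv.congr {a b : ℝ} {f f' h h' : ℝ → E} (H : HasWeakDeriv a b f f')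
    (e : f =ᵐ[ivl a b] h) (e' : f' =ᵐ[ivl a b] h') : HasWeakDeriv a b h h' := by
  intro φ h1 h2 h3
  have A := H φ h1 h2 h3
  rw [integral_congr_ae (e.mono fun x hx => by simp only [hx] :
      (fun x => deriv φ x • f x) =ᵐ[ivl a b] fun x => deriv φ x • h x),
    integral_congr_ae (e'.mono fun x hx => by simp only [hx] :
      (fun x => φ x • f' x) =ᵐ[ivl a b] fun x => φ x • h' x)] at A
  exact A

theorem HasWeakDeriv.add {a b : ℝ} {f f' h h' : ℝ → E} (hf : MemLp f 2 (ivl a b))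
    (hf' : MemLp f' 2 (ivl a b)) (hh : MemLp h 2 (ivl a b)) (hh' : MemLp h' 2 (ivl a b))
    (H : HasWeakDeriv a b f f') (K : HasWeakDeriv a b h h') :
    HasWeakDeriv a b (f + h) (f' + h') := by
  intro φ h1 h2 h3
  have hd : Continuous (deriv φ) := h1.continuous_deriv (by simp)
  simp only [Pi.add_apply, smul_add]
  rw [integral_add (integrable_test_smul hd h2.deriv hf) (integrable_test_smul hd h2.deriv hh),
    integral_add (integrable_test_smul h1.continuous h2 hf')
      (integrable_test_smul h1.continuous h2 hh'), H φ h1 h2 h3, K φ h1 h2 h3, neg_add]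

theorem HasWeakDeriv.const_smul {a b : ℝ} {f f' : ℝ → E} (c : ℝ) (H : HasWeakDeriv a b f f') :
    HasWeakDeriv a b (c • f) (c • f') := by
  intro φ h1 h2 h3
  have A := H φ h1 h2 h3
  simp only [Pi.smul_apply, smul_comm _ c]
  rw [integral_smul, integral_smul, A, smul_neg]

theorem HasWeakDeriv.zero (a b : ℝ) : HasWeakDeriv a b (0 : ℝ → E) 0 := by
  intro φ _ _ _
  simp

theorem HasValueAt.congr {a b x : ℝ} {c : E} {f h : ℝ → E} (H : HasValueAt a b f x c)
    (e : f =ᵐ[ivl a b] h) : HasValueAt a b h x c := by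
  obtain ⟨w, ⟨h1, h2⟩, h3⟩ := H
  exact ⟨w, ⟨h1, e.symm.trans h2⟩, h3⟩

theorem HasValueAt.add {a b x : ℝ} {c d : E} {f h : ℝ → E} (H : HasValueAt a b f x c)
    (K : HasValueAt a b h x d) : HasValueAt a b (f + h) x (c + d) := by
  obtain ⟨w, ⟨h1, h2⟩, rfl⟩ := H
  obtain ⟨z, ⟨k1, k2⟩, rfl⟩ := K
  exact ⟨w + z, ⟨h1.add k1, h2.add k2⟩, rfl⟩

theorem HasValueAt.const_smul {a b x : ℝ} {c : E} {f : ℝ → E} (s : ℝ)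
    (H : HasValueAt a b f x c) : HasValueAt a b (s • f) x (s • c) := by
  obtain ⟨w, ⟨h1, h2⟩, rfl⟩ := H
  exact ⟨s • w, ⟨h1.const_smul s, h2.const_smul s⟩, rfl⟩

theorem HasValueAt.zero (a b x : ℝ) : HasValueAt a b (0 : ℝ → E) x 0 :=
  ⟨0, ⟨continuousOn_const, Filter.EventuallyEq.rfl⟩, rfl⟩

end Calculus

/-- Membership of a function in the Sobolev space `H²(0, ℓ)`. -/
def IsH2 (ℓ : ℝ) (f : ℝ → ℝ) : Prop :=
  MemLp f 2 (ivl 0 ℓ) ∧ ∃ f₁ f₂ : ℝ → ℝ, MemLp f₁ 2 (ivl 0 ℓ) ∧ MemLp f₂ 2 (ivl 0 ℓ) ∧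
    HasWeakDeriv 0 ℓ f f₁ ∧ HasWeakDeriv 0 ℓ f₁ f₂

/-- The space `{v ∈ H²(0, ℓ) : v(0) = v_x(0) = 0}`. An element `v` is stored as the triple
`(v, v_x, v_xx)` of elements of `L²(0, ℓ)`, the second and third being the weak derivatives of
the first (and so determined by it); the ambient `ℓ²`-product then induces the Sobolev norm
`(‖v‖² + ‖v_x‖² + ‖v_xx‖²)^{1/2}`. Boundary values are those of the continuous representatives. -/
def cantileverSpace (ℓ : ℝ) : Submodule ℝ (PiLp 2 (fun _ : Fin 3 => L2 ℓ)) where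
  carrier := {v | HasWeakDeriv 0 ℓ (v 0 : ℝ → ℝ) (v 1 : ℝ → ℝ) ∧
    HasWeakDeriv 0 ℓ (v 1 : ℝ → ℝ) (v 2 : ℝ → ℝ) ∧
    HasValueAt 0 ℓ (v 0 : ℝ → ℝ) 0 0 ∧ HasValueAt 0 ℓ (v 1 : ℝ → ℝ) 0 0}
  zero_mem' := by
    have h : ((0 : L2 ℓ) : ℝ → ℝ) =ᵐ[ivl 0 ℓ] 0 := Lp.coeFn_zero _ _ _
    exact ⟨(HasWeakDeriv.zero 0 ℓ).congr h.symm h.symm,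
      (HasWeakDeriv.zero 0 ℓ).congr h.symm h.symm,
      (HasValueAt.zero 0 ℓ 0).congr h.symm, (HasValueAt.zero 0 ℓ 0).congr h.symm⟩
  add_mem' := by
    rintro v w ⟨h1, h2, h3, h4⟩ ⟨k1, k2, k3, k4⟩
    have e : ∀ i, (((v + w) i : L2 ℓ) : ℝ → ℝ) =ᵐ[ivl 0 ℓ] (v i : ℝ → ℝ) + (w i : ℝ → ℝ) :=
      fun i => Lp.coeFn_add _ _
    refine ⟨(HasWeakDeriv.add (Lp.memLp _) (Lp.memLp _) (Lp.memLp _) (Lp.memLp _) h1 k1).congr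
        (e 0).symm (e 1).symm,
      (HasWeakDeriv.add (Lp.memLp _) (Lp.memLp _) (Lp.memLp _) (Lp.memLp _) h2 k2).congr
        (e 1).symm (e 2).symm, ?_, ?_⟩
    · simpa using (h3.add k3).congr (e 0).symm
    · simpa using (h4.add k4).congr (e 1).symm
  smul_mem' := by
    rintro c v ⟨h1, h2, h3, h4⟩
    have e : ∀ i, (((c • v) i : L2 ℓ) : ℝ → ℝ) =ᵐ[ivl 0 ℓ] c • (v i : ℝ → ℝ) :=
      fun i => Lp.coeFn_smul _ _
    refine ⟨(h1.const_smul c).congr (e 0).symm (e 1).symm,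
      (h2.const_smul c).congr (e 1).symm (e 2).symm, ?_, ?_⟩
    · simpa using (h3.const_smul c).congr (e 0).symm
    · simpa using (h4.const_smul c).congr (e 1).symm

/-- The Hilbert space `V = {v ∈ H²(0, ℓ) : v(0) = v_x(0) = 0}` with the Sobolev norm. -/
abbrev V (ℓ : ℝ) : Type := cantileverSpace ℓ

/-- `v` as an element of `L²(0, ℓ)`. -/
def V.fn {ℓ : ℝ} (v : V ℓ) : L2 ℓ := v.1 0

/-- The derivative `v_x` in `L²(0, ℓ)`. -/
def V.dx {ℓ : ℝ} (v : V ℓ) : L2 ℓ := v.1 1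

/-- The second derivative `v_xx` in `L²(0, ℓ)`. -/
def V.dxx {ℓ : ℝ} (v : V ℓ) : L2 ℓ := v.1 2

theorem V.norm_sq {ℓ : ℝ} (v : V ℓ) :
    ‖v‖ ^ 2 = ‖v.fn‖ ^ 2 + ‖v.dx‖ ^ 2 + ‖v.dxx‖ ^ 2 := by
  rw [Submodule.coe_norm, PiLp.norm_sq_eq_of_L2, Fin.sum_univ_three]
  rfl

theorem V.exists_rep {ℓ : ℝ} (v : V ℓ) : ∃ w : ℝ → ℝ, IsContRep 0 ℓ (v.fn : ℝ → ℝ) w := by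
  obtain ⟨w, hw, -⟩ := v.2.2.2.1
  exact ⟨w, hw⟩

/-- The representative of `v` that is continuous on `[0, ℓ]` (unique there if `0 < ℓ`). -/
def V.rep {ℓ : ℝ} (v : V ℓ) : ℝ → ℝ := v.exists_rep.choose

theorem V.rep_spec {ℓ : ℝ} (v : V ℓ) : IsContRep 0 ℓ (v.fn : ℝ → ℝ) v.rep :=
  v.exists_rep.choose_spec

/-- `u ∈ L²(0,T;V)` is a weak solution of the damped cantilever problem
`ρ u_tt + μ u_t + (r u_xx)_xx + (κ u_xxt)_xx = 0`, `u(0) = u₀`, `u_t(0) = v₀`,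
clamped at `x = 0`, with zero moment and shear force `g` at `x = ℓ`,
whose weak time derivatives are `u_t = ut ∈ L²(0,T;V)` and `u_tt = utt ∈ L²(0,T;L²(0,ℓ))`.
Time derivatives are weak derivatives of `L²(0,ℓ)`-valued functions; initial values are those of
the representatives `u ∈ C([0,T];V)` and `u_t ∈ C([0,T];L²(0,ℓ))`. -/
structure IsWeakSolutionWith (ℓ T : ℝ) (ρ μ r κ g : ℝ → ℝ) (u₀ v₀ : V ℓ)
    (u ut : Lp (V ℓ) 2 (ivl 0 T)) (utt : Lp (L2 ℓ) 2 (ivl 0 T)) : Prop where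
  deriv_one : HasWeakDeriv 0 T (fun t => (u t).fn) (fun t => (ut t).fn)
  deriv_two : HasWeakDeriv 0 T (fun t => (ut t).fn) (fun t => utt t)
  equation : ∀ v : V ℓ, ∀ᵐ t ∂(ivl 0 T),
    (∫ x, ρ x * (utt t) x * v.fn x ∂(ivl 0 ℓ)) + (∫ x, μ x * (ut t).fn x * v.fn x ∂(ivl 0 ℓ))
      + (∫ x, r x * (u t).dxx x * v.dxx x ∂(ivl 0 ℓ))
      + (∫ x, κ x * (ut t).dxx x * v.dxx x ∂(ivl 0 ℓ)) = g t * v.rep ℓ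
  init_u : HasValueAt 0 T (fun t => u t) 0 u₀
  init_ut : HasValueAt 0 T (fun t => (ut t).fn) 0 v₀.fn

/-- `u` is a weak solution of the damped cantilever problem. -/
def IsWeakSolution (ℓ T : ℝ) (ρ μ r κ g : ℝ → ℝ) (u₀ v₀ : V ℓ)
    (u : Lp (V ℓ) 2 (ivl 0 T)) : Prop :=
  ∃ (ut : Lp (V ℓ) 2 (ivl 0 T)) (utt : Lp (L2 ℓ) 2 (ivl 0 T)),
    IsWeakSolutionWith ℓ T ρ μ r κ g u₀ v₀ u ut utt

/-- `C* = 4ℓ²(1 + 4ℓ²) + 1`. -/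
def Cstar (ℓ : ℝ) : ℝ := 4 * ℓ ^ 2 * (1 + 4 * ℓ ^ 2) + 1

/-- `C₀² = e^T - 1`. -/
def C0sq (T : ℝ) : ℝ := Real.exp T - 1

/-- `R₀(u₀, v₀) = ρ₁ ‖v₀‖² + r₁ ‖u₀,xx‖²`. -/
def R0 {ℓ : ℝ} (ρ₁ r₁ : ℝ) (u₀ v₀ : V ℓ) : ℝ := ρ₁ * ‖v₀.fn‖ ^ 2 + r₁ * ‖u₀.dxx‖ ^ 2

/-- `R₁(u₀, v₀) = ‖v₀‖² + ‖u₀,xx‖² + ‖v₀,xx‖²`. -/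
def R1 {ℓ : ℝ} (u₀ v₀ : V ℓ) : ℝ := ‖v₀.fn‖ ^ 2 + ‖u₀.dxx‖ ^ 2 + ‖v₀.dxx‖ ^ 2

/-- The auxiliary constant `A` in the definition of `C₁²`. -/
def constA (ℓ T r₀ r₁ κ₀ : ℝ) : ℝ :=
  (4 * r₁ ^ 2 * (ℓ ^ 3 + 3) / (3 * r₀) + κ₀ * ℓ ^ 3 / (4 * (ℓ ^ 3 + 3)) + r₁)
    * ((C0sq T + 1) / κ₀)

/-- `C₁²`, the maximum of `2A/(3r₀) + 2(ℓ³+3)/(3ℓ³κ₀)`, `Aρ₁ + μ₁`, `Ar₁ + r₁²`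
and `κ₁ + 1`. -/
def C1sq (ℓ T ρ₁ μ₁ r₀ r₁ κ₀ κ₁ : ℝ) : ℝ :=
  max (max (constA ℓ T r₀ r₁ κ₀ * (2 / (3 * r₀)) + 2 * (ℓ ^ 3 + 3) / (3 * ℓ ^ 3 * κ₀))
      (constA ℓ T r₀ r₁ κ₀ * ρ₁ + μ₁))
    (max (constA ℓ T r₀ r₁ κ₀ * r₁ + r₁ ^ 2) (κ₁ + 1))

end KVBeam

end

/-! A square integrable function has weak derivative `f'` and initial value `c` exactly when it is
a.e. `c + ∫₀ᵗ f'` (`hasWeakDeriv_and_hasValueAt_iff`). In space this makes `V` a closed subspace,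
hence a Hilbert space, and gives `‖v‖² ≤ C* ‖v_xx‖²` and `v(ℓ)² ≤ (ℓ³/3) ‖v_xx‖²`. In time it turns
the notion of weak solution into linear identities between elements of `L²(0,T)` spaces, built from
bounded operators (`isWeakSolutionWith_iff`). The rest is Hilbert space theory for an abstract
`DampedSystem`.

Existence: the term `ε ⟪u_tt, v⟫`, with the inner product of `V`, is added to the mass form. The
mass form is then coercive on `V`, and by Lax–Milgram the equation becomes a linear ODE with a
bounded generator on `V × V` (`exists_isRegularized`). Its solutions are smooth enough to be tested
with `u_t` and with `u_tt`. Testing with `u_t` and Gronwall's inequality bound `u_xx` and `u_xxt`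
(`energy_le`); testing with `u_tt` bounds the acceleration (`integral_acceleration_le`). Since `g(0)
= 0`, the load is integrated by parts in time, so only `g'` and tip values of `u` or `u_t` occur,
and these are absorbed by the `r` or `κ` form. All bounds converge to the asserted ones as `ε → 0`.
Weak limits satisfy the equation because it is linear and `ε u_tt → 0` in norm; they inherit the
bounds because the norm is weakly lower semicontinuous (`exists_isSolution`).

Uniqueness: for zero data the equation is integrated once in time and tested with `u(t)`, which
makes an energy of `u` and `∫ u` nonincreasing (`IsSolution.eq_zero`). The estimates, shown for the
constructed solution, then hold for every solution. -/

noncomputable section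

namespace KVBeam

open Filter Topology
open scoped InnerProductSpace

set_option linter.unusedSectionVars false

/-! ### Primitives of vector-valued functions on an interval. -/

section Primitive

variable {E F : Type*} [NormedAddCommGroup E] [NormedSpace ℝ E]
  [NormedAddCommGroup F] [NormedSpace ℝ F]

/-- The primitive `t ↦ ∫₀ᵗ f` of a function on `(0, b)`, extended by zero to the line. -/
def prim (b : ℝ) (f : ℝ → E) (t : ℝ) : E := ∫ s in (0 : ℝ)..t, (Ioo 0 b).indicator f s

theorem integrable_indicator_of_ivl {b : ℝ} {f : ℝ → E} (hf : Integrable f (ivl 0 b)) :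
    Integrable ((Ioo 0 b).indicator f) :=
  (integrable_indicator_iff measurableSet_Ioo).2 hf

theorem continuous_prim {b : ℝ} {f : ℝ → E} (hf : Integrable f (ivl 0 b)) :
    Continuous (prim b f) :=
  intervalIntegral.continuous_primitive
    (fun _ _ => (integrable_indicator_of_ivl hf).intervalIntegrable) 0

@[simp] theorem prim_zero_right (b : ℝ) (f : ℝ → E) : prim b f 0 = 0 := by simp [prim]

theorem prim_congr {b : ℝ} {f h : ℝ → E} (e : f =ᵐ[ivl 0 b] h) : prim b f = prim b h := by
  funext t
  refine intervalIntegral.integral_congr_ae ?_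
  filter_upwards [(ae_restrict_iff' measurableSet_Ioo).1 e] with x hx _
  by_cases h' : x ∈ Ioo 0 b
  · simp [h', hx h']
  · simp [h']

theorem prim_add {b : ℝ} {f h : ℝ → E} (hf : Integrable f (ivl 0 b))
    (hh : Integrable h (ivl 0 b)) (t : ℝ) : prim b (f + h) t = prim b f t + prim b h t := by
  simp only [prim, indicator_add']
  exact intervalIntegral.integral_add (integrable_indicator_of_ivl hf).intervalIntegrable
    (integrable_indicator_of_ivl hh).intervalIntegrable

theorem prim_smul (b : ℝ) (c : ℝ) (f : ℝ → E) (t : ℝ) : prim b (c • f) t = c • prim b f t := by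
  simp only [prim, ← intervalIntegral.integral_smul]
  congr 1
  funext s
  by_cases h : s ∈ Ioo 0 b <;> simp [h]

theorem prim_clm [CompleteSpace E] [CompleteSpace F] {b : ℝ} {f : ℝ → E}
    (hf : Integrable f (ivl 0 b)) (L : E →L[ℝ] F) (t : ℝ) :
    prim b (fun s => L (f s)) t = L (prim b f t) := by
  unfold prim
  rw [← L.intervalIntegral_comp_comm (integrable_indicator_of_ivl hf).intervalIntegrable]
  congr 1
  funext s
  by_cases h : s ∈ Ioo 0 b <;> simp [h]

theorem prim_eq_intervalIntegral {b t : ℝ} (ht : t ∈ Icc 0 b) (f : ℝ → E) :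
    prim b f t = ∫ s in (0 : ℝ)..t, f s := by
  refine intervalIntegral.integral_congr_ae ?_
  have : ∀ᵐ x : ℝ, x ≠ b := by simp [ae_iff]
  filter_upwards [this] with x hx hxt
  rw [uIoc_of_le ht.1] at hxt
  exact indicator_of_mem (show x ∈ Ioo 0 b from ⟨hxt.1, lt_of_le_of_ne (hxt.2.trans ht.2) hx⟩) f

theorem integral_ivl_eq {b : ℝ} (hb : 0 ≤ b) (f : ℝ → E) :
    ∫ x, f x ∂(ivl 0 b) = ∫ x in (0 : ℝ)..b, f x := by
  rw [intervalIntegral.integral_of_le hb, integral_Ioc_eq_integral_Ioo]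

theorem norm_prim_le {b t : ℝ} (ht : 0 ≤ t) {f : ℝ → E} (hf : Integrable f (ivl 0 b)) :
    ‖prim b f t‖ ≤ ∫ s, ‖f s‖ ∂(ivl 0 b) := by
  unfold prim
  rw [intervalIntegral.integral_of_le ht]
  refine (norm_integral_le_integral_norm _).trans ?_
  refine (setIntegral_le_integral (integrable_indicator_of_ivl hf).norm
    (Filter.Eventually.of_forall fun x => norm_nonneg _)).trans ?_
  simp only [norm_indicator_eq_indicator_norm]
  rw [integral_indicator measurableSet_Ioo]

/-- Cauchy–Schwarz against the constant function one. -/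
theorem integral_norm_ivl_le {b : ℝ} (hb : 0 ≤ b) (f : Lp E 2 (ivl 0 b)) :
    ∫ s, ‖f s‖ ∂(ivl 0 b) ≤ √b * ‖f‖ := by
  have h1 : eLpNorm f 1 (ivl 0 b) ≤ eLpNorm f 2 (ivl 0 b) * (ivl 0 b) univ ^ (1 / (1:ℝ) - 1 / 2) :=
    by simpa using eLpNorm_le_eLpNorm_mul_rpow_measure_univ (p := 1) (q := 2) (by norm_num)
        (Lp.aestronglyMeasurable f)
  have h2 : ∫ s, ‖f s‖ ∂(ivl 0 b) = (eLpNorm f 1 (ivl 0 b)).toReal := by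
    rw [integral_norm_eq_lintegral_enorm (Lp.aestronglyMeasurable f), eLpNorm_one_eq_lintegral_enorm]
  have h3 : (ivl 0 b) univ ^ (1 / (1:ℝ) - 1 / 2) = ENNReal.ofReal (√b) := by
    rw [Measure.restrict_apply_univ, Real.volume_Ioo, sub_zero, Real.sqrt_eq_rpow,
      ENNReal.ofReal_rpow_of_nonneg hb (by norm_num)]
    norm_num
  rw [h2, Lp.norm_def, mul_comm]
  rw [h3] at h1
  have := ENNReal.toReal_mono (ENNReal.mul_ne_top (Lp.eLpNorm_ne_top f) ENNReal.ofReal_ne_top) h1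
  rwa [ENNReal.toReal_mul, ENNReal.toReal_ofReal (Real.sqrt_nonneg b)] at this

theorem Lp.integrable_ivl {b : ℝ} (f : Lp E 2 (ivl 0 b)) : Integrable f (ivl 0 b) :=
  (Lp.memLp f).integrable (by norm_num)

theorem norm_prim_Lp_le {b t : ℝ} (hb : 0 ≤ b) (ht : 0 ≤ t) (f : Lp E 2 (ivl 0 b)) :
    ‖prim b f t‖ ≤ √b * ‖f‖ :=
  (norm_prim_le ht (Lp.integrable_ivl f)).trans (integral_norm_ivl_le hb f)

theorem hasDerivAt_prim [CompleteSpace E] {b t : ℝ} {f : ℝ → E} (hf : Continuous f)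
    (ht : t ∈ Ioo 0 b) : HasDerivAt (prim b f) (f t) t := by
  have h := intervalIntegral.integral_hasDerivAt_right (hf.intervalIntegrable 0 t)
    (hf.stronglyMeasurableAtFilter _ _) hf.continuousAt
  refine h.congr_of_eventuallyEq ?_
  filter_upwards [isOpen_Ioo.mem_nhds ht] with s hs
  exact prim_eq_intervalIntegral ⟨hs.1.le, hs.2.le⟩ f

/-- The primitive is only absolutely continuous, with derivative `f` almost everywhere, so
integration by parts is used in its absolutely continuous form. -/
theorem prim_parts_real {b : ℝ} {f φ : ℝ → ℝ} (hf : Integrable f (ivl 0 b))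
    (hφ : ContDiff ℝ 1 φ) (t : ℝ) :
    ∫ s in (0 : ℝ)..t, deriv φ s * prim b f s
      = φ t * prim b f t - ∫ s in (0 : ℝ)..t, φ s * (Ioo 0 b).indicator f s := by
  have hi := integrable_indicator_of_ivl hf
  have h1 : AbsolutelyContinuousOnInterval φ 0 t :=
    hφ.contDiffOn.absolutelyContinuousOnInterval
  have h2 : AbsolutelyContinuousOnInterval (prim b f) 0 t :=
    hi.intervalIntegrable.absolutelyContinuousOnInterval_intervalIntegral (by simp)
  have h3 : ∀ᵐ x : ℝ, deriv (prim b f) x = (Ioo 0 b).indicator f x := by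
    filter_upwards [LocallyIntegrable.ae_hasDerivAt_integral hi.locallyIntegrable] with x hx
    exact (hx 0).deriv
  have h4 := h1.integral_mul_deriv_eq_deriv_mul h2
  rw [prim_zero_right, mul_zero, sub_zero] at h4
  rw [eq_sub_iff_add_eq', ← eq_sub_iff_add_eq, ← h4]
  exact intervalIntegral.integral_congr_ae (h3.mono fun x hx _ => by rw [hx])

/-- Continuous linear functionals separate points and commute with integrals, which reduces the
claim to the scalar case. -/
theorem prim_parts [CompleteSpace E] {b : ℝ} {f : ℝ → E} {φ : ℝ → ℝ}
    (hf : Integrable f (ivl 0 b)) (hφ : ContDiff ℝ 1 φ) (t : ℝ) :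
    ∫ s in (0 : ℝ)..t, deriv φ s • prim b f s
      = φ t • prim b f t - ∫ s in (0 : ℝ)..t, φ s • (Ioo 0 b).indicator f s := by
  refine (SeparatingDual.eq_iff_forall_dual_eq (R := ℝ)).2 fun L => ?_
  have hi := integrable_indicator_of_ivl hf
  have h1 : IntervalIntegrable (fun s => deriv φ s • prim b f s) volume 0 t :=
    ((hφ.continuous_deriv le_rfl).smul (continuous_prim hf)).intervalIntegrable _ _
  have h2 : IntervalIntegrable (fun s => φ s • (Ioo 0 b).indicator f s) volume 0 t :=
    hi.intervalIntegrable.continuousOn_smul hφ.continuous.continuousOn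
  rw [map_sub, ← L.intervalIntegral_comp_comm h1, ← L.intervalIntegral_comp_comm h2]
  have h3 := prim_parts_real (L.integrable_comp hf) hφ t
  simp only [map_smul, smul_eq_mul, ← prim_clm hf]
  convert h3 using 5
  rename_i s
  by_cases h : s ∈ Ioo 0 b <;> simp [h]

theorem memLp_prim {b : ℝ} {f : ℝ → E} (hf : Integrable f (ivl 0 b)) :
    MemLp (prim b f) 2 (ivl 0 b) := by
  have h := (isCompact_Icc (a := (0:ℝ)) (b := b)).exists_bound_of_continuousOn
    (continuous_prim hf).continuousOn
  obtain ⟨C, hC⟩ := h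
  refine MemLp.of_bound (continuous_prim hf).aestronglyMeasurable C ?_
  filter_upwards [ae_restrict_mem measurableSet_Ioo] with x hx
  exact hC x ⟨hx.1.le, hx.2.le⟩

theorem eqOn_Icc_of_ae_eq {b : ℝ} (hb : 0 < b) {f h : ℝ → E} (hf : ContinuousOn f (Icc 0 b))
    (hh : ContinuousOn h (Icc 0 b)) (e : f =ᵐ[ivl 0 b] h) : EqOn f h (Icc 0 b) := by
  have e' : EqOn f h (Ioo 0 b) := by
    refine Measure.eqOn_open_of_ae_eq e isOpen_Ioo (hf.mono Ioo_subset_Icc_self)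
      (hh.mono Ioo_subset_Icc_self)
  exact e'.of_subset_closure hf hh Ioo_subset_Icc_self (by rw [closure_Ioo hb.ne])

end Primitive

/-! ### Weak derivatives with an initial value are primitives. -/

section WeakDerivative

variable {E : Type*} [NormedAddCommGroup E] [NormedSpace ℝ E] [CompleteSpace E]

theorem hasWeakDeriv_const_add_prim {b : ℝ} (hb : 0 ≤ b) {f : ℝ → E} (hf : Integrable f (ivl 0 b))
    (c : E) : HasWeakDeriv 0 b (fun t => c + prim b f t) f := by
  intro φ h1 h2 h3
  have hd : Continuous (deriv φ) := h1.continuous_deriv (by simp)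
  have z : ∀ x, x ∉ Ioo 0 b → φ x = 0 := fun x hx =>
    image_eq_zero_of_notMem_tsupport fun h => hx (h3 h)
  rw [integral_ivl_eq hb, integral_ivl_eq hb]
  simp only [smul_add]
  rw [intervalIntegral.integral_add, prim_parts hf (h1.of_le (by simp)),
    z b (by simp), zero_smul, zero_sub, intervalIntegral.integral_smul_const,
    intervalIntegral.integral_deriv_eq_sub' φ, z b (by simp), z 0 (by simp), sub_zero, zero_smul,
    zero_add]
  · congr 2
    funext s
    by_cases h : s ∈ Ioo 0 b
    · simp [h]
    · simp [h, z s h]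
  · rfl
  · exact fun x _ => (h1.differentiable (by simp)).differentiableAt
  · exact hd.continuousOn
  · exact (hd.smul continuous_const).intervalIntegrable _ _
  · exact (hd.smul (continuous_prim hf)).intervalIntegrable _ _

theorem ae_eq_zero_of_test {b : ℝ} {f : ℝ → E} (hf : Integrable f (ivl 0 b))
    (h : ∀ φ : ℝ → ℝ, ContDiff ℝ ∞ φ → HasCompactSupport φ → tsupport φ ⊆ Ioo 0 b →
      ∫ x, φ x • f x ∂(ivl 0 b) = 0) : f =ᵐ[ivl 0 b] 0 := by
  have h0 := isOpen_Ioo.ae_eq_zero_of_integral_contDiff_smul_eq_zero (μ := volume)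
    (f := f) (U := Ioo 0 b) (IntegrableOn.locallyIntegrableOn hf) fun φ h1 h2 h3 => by
      rw [← h φ h1 h2 h3]
      refine (setIntegral_eq_integral_of_forall_compl_eq_zero fun x hx => ?_).symm
      rw [image_eq_zero_of_notMem_tsupport fun h => hx (h3 h), zero_smul]
  exact (ae_restrict_iff' measurableSet_Ioo).2 h0

theorem HasWeakDeriv.unique {b : ℝ} {f f₁ f₂ : ℝ → E} (h₁ : HasWeakDeriv 0 b f f₁)
    (h₂ : HasWeakDeriv 0 b f f₂) (i₁ : MemLp f₁ 2 (ivl 0 b)) (i₂ : MemLp f₂ 2 (ivl 0 b)) :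
    f₁ =ᵐ[ivl 0 b] f₂ := by
  have := ae_eq_zero_of_test (f := f₁ - f₂) ((i₁.sub i₂).integrable (by norm_num)) ?_
  · filter_upwards [this] with x hx
    simpa [sub_eq_zero] using hx
  · intro φ a b c
    simp only [Pi.sub_apply, smul_sub]
    rw [integral_sub (integrable_test_smul a.continuous b i₁)
      (integrable_test_smul a.continuous b i₂), sub_eq_zero, ← neg_inj, ← h₁ φ a b c,
      ← h₂ φ a b c]

/-- The primitive starting at the least point `p` of the support vanishes to the left of `p`, and
beyond the greatest point `q` because the total integral is zero. -/
theorem exists_test_primitive {b : ℝ} {ψ : ℝ → ℝ} (h1 : ContDiff ℝ ∞ ψ)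
    (h2 : HasCompactSupport ψ) (h3 : tsupport ψ ⊆ Ioo 0 b) (h0 : ∫ x, ψ x = 0) :
    ∃ φ : ℝ → ℝ, ContDiff ℝ ∞ φ ∧ HasCompactSupport φ ∧ tsupport φ ⊆ Ioo 0 b ∧
      deriv φ = ψ := by
  rcases (tsupport ψ).eq_empty_or_nonempty with he | hne
  · refine ⟨0, contDiff_const, HasCompactSupport.zero, by simp [tsupport], ?_⟩
    rw [tsupport_eq_empty_iff.1 he]
    exact deriv_const' 0
  obtain ⟨p, hp⟩ := h2.isCompact.exists_isLeast hne
  obtain ⟨q, hq⟩ := h2.isCompact.exists_isGreatest hne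
  have zp : ∀ x, x < p → ψ x = 0 := fun x hx =>
    image_eq_zero_of_notMem_tsupport fun h => absurd (hp.2 h) (not_le.2 hx)
  have zq : ∀ x, q < x → ψ x = 0 := fun x hx =>
    image_eq_zero_of_notMem_tsupport fun h => absurd (hq.2 h) (not_le.2 hx)
  have hpq : p ≤ q := hp.2 hq.1
  set φ : ℝ → ℝ := fun x => ∫ s in p..x, ψ s with hφ
  have hd : ∀ x, HasDerivAt φ (ψ x) x := fun x =>
    intervalIntegral.integral_hasDerivAt_right (h1.continuous.intervalIntegrable _ _)
      (h1.continuous.stronglyMeasurableAtFilter _ _) h1.continuous.continuousAt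
  have hd' : deriv φ = ψ := funext fun x => (hd x).deriv
  have zlt : ∀ x, x < p → φ x = 0 := fun x hx => by
    simp only [hφ]
    rw [intervalIntegral.integral_of_ge hx.le, integral_Ioc_eq_integral_Ioo,
      setIntegral_eq_zero_of_forall_eq_zero fun y hy => zp y hy.2, neg_zero]
  have hsupp : Function.support ψ ⊆ Icc p q := fun x hx =>
    ⟨not_lt.1 fun h => hx (zp x h), not_lt.1 fun h => hx (zq x h)⟩
  have zgt : ∀ x, q < x → φ x = 0 := fun x hx => by
    simp only [hφ]
    rw [intervalIntegral.integral_of_le (hpq.trans hx.le), ← integral_Icc_eq_integral_Ioc, ← h0]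
    refine setIntegral_eq_integral_of_forall_compl_eq_zero fun y hy => ?_
    by_contra h
    exact hy ⟨(hsupp h).1, (hsupp h).2.trans hx.le⟩
  have hs : tsupport φ ⊆ Icc p q := by
    refine closure_minimal (fun x hx => ?_) isClosed_Icc
    exact ⟨not_lt.1 fun h => hx (zlt x h), not_lt.1 fun h => hx (zgt x h)⟩
  refine ⟨φ, ?_, isCompact_Icc.of_isClosed_subset (isClosed_tsupport _) hs, ?_, hd'⟩
  · exact contDiff_infty_iff_deriv.2 ⟨fun x => (hd x).differentiableAt, hd' ▸ h1⟩
  · exact hs.trans fun x hx => ⟨(h3 hp.1).1.trans_le hx.1, hx.2.trans_lt (h3 hq.1).2⟩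

/-- The du Bois-Reymond argument: for a fixed test function `η` of integral one, `ψ - (∫ ψ) η` has
mean zero and so is the derivative of a test function. Hence `∫ ψ f = (∫ ψ) ∫ η f` for every test
function `ψ`, and the constant is `∫ η f`. -/
theorem exists_ae_eq_const_of_hasWeakDeriv_zero {b : ℝ} (hb : 0 < b) {f : ℝ → E}
    (hf : MemLp f 2 (ivl 0 b)) (h : HasWeakDeriv 0 b f 0) :
    ∃ c : E, f =ᵐ[ivl 0 b] fun _ => c := by
  let B : ContDiffBump (b / 2 : ℝ) := ⟨b / 8, b / 4, by positivity, by linarith⟩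
  let η : ℝ → ℝ := B.normed volume
  have e1 : ContDiff ℝ ∞ η := B.contDiff_normed
  have e2 : HasCompactSupport η := B.hasCompactSupport_normed
  have e3 : tsupport η ⊆ Ioo 0 b := by
    rw [show tsupport η = Metric.closedBall (b / 2) B.rOut from B.tsupport_normed_eq,
      Real.closedBall_eq_Icc]
    intro x hx
    have : B.rOut = b / 4 := rfl
    rw [this] at hx
    exact ⟨by linarith [hx.1], by linarith [hx.2]⟩
  have e4 : ∫ x, η x = 1 := B.integral_normed
  have hi : Integrable f (ivl 0 b) := hf.integrable (by norm_num)
  refine ⟨∫ x, η x • f x ∂(ivl 0 b), ?_⟩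
  set c := ∫ x, η x • f x ∂(ivl 0 b) with hc
  have key := ae_eq_zero_of_test (f := fun x => f x - c) (hi.sub (integrable_const c)) ?_
  · filter_upwards [key] with x hx
    simpa [sub_eq_zero] using hx
  intro ψ h1 h2 h3
  set m := ∫ x, ψ x with hm
  have s3 : tsupport (fun x => ψ x - m * η x) ⊆ Ioo 0 b := by
    refine (tsupport_sub _ _).trans (union_subset h3 ?_)
    exact (closure_mono fun x hx => right_ne_zero_of_mul hx).trans e3
  obtain ⟨φ, a1, a2, a3, a4⟩ := exists_test_primitive (b := b) (ψ := fun x => ψ x - m * η x)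
    (h1.sub (contDiff_const.mul e1)) (h2.sub e2.mul_left) s3 (by
      rw [integral_sub (h1.continuous.integrable_of_hasCompactSupport h2)
        ((e1.continuous.integrable_of_hasCompactSupport e2).const_mul m),
        integral_const_mul, e4, mul_one, sub_self])
  have := h φ a1 a2 a3
  rw [a4] at this
  simp only [sub_smul, mul_smul, Pi.zero_apply, smul_zero, integral_zero, neg_zero] at this
  rw [integral_sub (integrable_test_smul h1.continuous h2 hf)
    (Integrable.fun_smul m (integrable_test_smul e1.continuous e2 hf)), integral_smul, ← hc] at this
  simp only [smul_sub]
  rw [integral_sub (integrable_test_smul h1.continuous h2 hf)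
    ((h1.continuous.integrable_of_hasCompactSupport h2).restrict.smul_const c),
    integral_smul_const, ← this]
  congr 2
  refine setIntegral_eq_integral_of_forall_compl_eq_zero fun x hx => ?_
  exact image_eq_zero_of_notMem_tsupport fun h => hx (h3 h)

/-- A square integrable function on `(0, b)` has the weak derivative `f'` and the initial value
`c` if and only if it is the primitive of `f'` that starts at `c`. -/
theorem hasWeakDeriv_and_hasValueAt_iff {b : ℝ} (hb : 0 < b) {f f' : ℝ → E} {c : E}
    (hf : MemLp f 2 (ivl 0 b)) (hf' : MemLp f' 2 (ivl 0 b)) :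
    HasWeakDeriv 0 b f f' ∧ HasValueAt 0 b f 0 c ↔
      f =ᵐ[ivl 0 b] fun t => c + prim b f' t := by
  have hi' : Integrable f' (ivl 0 b) := hf'.integrable (by norm_num)
  constructor
  · rintro ⟨h, w, ⟨w1, w2⟩, w3⟩
    have h1 := hasWeakDeriv_const_add_prim hb.le hi' 0
    have mp : MemLp (fun t => (0 : E) + prim b f' t) 2 (ivl 0 b) := by
      simpa using memLp_prim hi'
    -- The difference of `f` and the primitive of `f'` has weak derivative zero, hence is a constant
    -- `d`; comparing continuous representatives at `0` gives `d = c`.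
    have h2 := h.add hf hf' (mp.const_smul (-1 : ℝ)) (hf'.const_smul (-1 : ℝ))
      (h1.const_smul (-1))
    obtain ⟨d, hd⟩ := exists_ae_eq_const_of_hasWeakDeriv_zero hb
      (hf.add (mp.const_smul (-1 : ℝ))) (by
        convert h2 using 1
        funext x; simp)
    have hd' : f =ᵐ[ivl 0 b] fun t => d + prim b f' t := by
      filter_upwards [hd] with x hx
      rw [← hx]; simp
    have h3 := eqOn_Icc_of_ae_eq hb w1
      (h := fun t => d + prim b f' t)
      ((continuous_const.add (continuous_prim hi')).continuousOn) (w2.symm.trans hd')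
    have h4 := h3 (left_mem_Icc.2 hb.le)
    simp only [prim_zero_right, add_zero, w3] at h4
    rwa [h4]
  · intro e
    refine ⟨(hasWeakDeriv_const_add_prim hb.le hi' c).congr e.symm (ae_eq_refl _), _, ⟨?_, e⟩, ?_⟩
    · exact (continuous_const.add (continuous_prim hi')).continuousOn
    · simp

end WeakDerivative

/-! ### Integration as a bounded operator on `L²`. -/

section Operators

variable {E F : Type*} [NormedAddCommGroup E] [NormedSpace ℝ E]
  [NormedAddCommGroup F] [NormedSpace ℝ F]

/-- Integration from the left end point, as an operator on `L²(0, b; E)`. -/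
def primL {b : ℝ} (hb : 0 ≤ b) : Lp E 2 (ivl 0 b) →L[ℝ] Lp E 2 (ivl 0 b) :=
  LinearMap.mkContinuous
    { toFun := fun f => (memLp_prim (Lp.integrable_ivl f)).toLp
      map_add' := fun f h => by
        rw [← MemLp.toLp_add]
        refine MemLp.toLp_congr _ _ (Eventually.of_forall fun t => ?_)
        rw [prim_congr (Lp.coeFn_add f h),
          prim_add (Lp.integrable_ivl f) (Lp.integrable_ivl h)]
        rfl
      map_smul' := fun c f => by
        rw [RingHom.id_apply, ← MemLp.toLp_const_smul]
        refine MemLp.toLp_congr _ _ (Eventually.of_forall fun t => ?_)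
        rw [prim_congr (Lp.coeFn_smul c f), prim_smul]
        rfl }
    (measureUnivNNReal (ivl 0 b) ^ (ENNReal.toReal 2)⁻¹ * √b) fun f => by
      rw [mul_assoc]
      refine Lp.norm_le_of_ae_bound (by positivity) ?_
      filter_upwards [MemLp.coeFn_toLp (memLp_prim (Lp.integrable_ivl f)),
        ae_restrict_mem measurableSet_Ioo] with x hx h'x
      exact (congrArg norm hx).le.trans (norm_prim_Lp_le hb h'x.1.le f)

theorem coeFn_primL {b : ℝ} (hb : 0 ≤ b) (f : Lp E 2 (ivl 0 b)) :
    primL hb f =ᵐ[ivl 0 b] prim b f :=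
  MemLp.coeFn_toLp (memLp_prim (Lp.integrable_ivl f))

/-- The value of the primitive at a point, as an operator on `L²(0, b; E)`. -/
def primEval {b t : ℝ} (hb : 0 ≤ b) (ht : 0 ≤ t) : Lp E 2 (ivl 0 b) →L[ℝ] E :=
  LinearMap.mkContinuous
    { toFun := fun f => prim b f t
      map_add' := fun f h => by
        rw [prim_congr (Lp.coeFn_add f h),
          prim_add (Lp.integrable_ivl f) (Lp.integrable_ivl h)]
      map_smul' := fun c f => by
        rw [RingHom.id_apply, prim_congr (Lp.coeFn_smul c f), prim_smul] }
    (√b) fun f => norm_prim_Lp_le hb ht f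

@[simp] theorem primEval_apply {b t : ℝ} (hb : 0 ≤ b) (ht : 0 ≤ t) (f : Lp E 2 (ivl 0 b)) :
    primEval hb ht f = prim b f t := rfl

theorem compLpL_primL [CompleteSpace E] [CompleteSpace F] {b : ℝ} (hb : 0 ≤ b) (L : E →L[ℝ] F)
    (f : Lp E 2 (ivl 0 b)) :
    L.compLpL 2 (ivl 0 b) (primL hb f) = primL hb (L.compLpL 2 (ivl 0 b) f) := by
  ext1
  filter_upwards [L.coeFn_compLpL (p := 2) (primL hb f), coeFn_primL hb f,
    coeFn_primL hb (L.compLpL 2 (ivl 0 b) f)] with t h1 h2 h3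
  rw [h1, h2, h3, prim_congr (L.coeFn_compLpL (p := 2) f), prim_clm (Lp.integrable_ivl f)]

/-- The constant function with value `c`, in `L²(0, b; E)`. -/
def constLp (b : ℝ) (c : E) : Lp E 2 (ivl 0 b) := (memLp_const c).toLp

theorem coeFn_constLp (b : ℝ) (c : E) : constLp b c =ᵐ[ivl 0 b] fun _ => c :=
  MemLp.coeFn_toLp _

theorem eq_constLp_add_primL_iff {b : ℝ} (hb : 0 ≤ b) {f f' : Lp E 2 (ivl 0 b)} {c : E} :
    f = constLp b c + primL hb f' ↔ f =ᵐ[ivl 0 b] fun t => c + prim b f' t := by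
  have h : constLp b c + primL hb f' =ᵐ[ivl 0 b] fun t => c + prim b f' t := by
    filter_upwards [Lp.coeFn_add (constLp b c) (primL hb f'), coeFn_constLp b c,
      coeFn_primL hb f'] with t h1 h2 h3
    rw [h1, Pi.add_apply, h2, h3]
  exact ⟨fun e => e ▸ h, fun e => Lp.ext (e.trans h.symm)⟩

end Operators

/-! ### Weak convergence in Hilbert spaces along filters. -/

section WeakLimits

variable {ι X Y : Type*} [NormedAddCommGroup X] [InnerProductSpace ℝ X]
  [NormedAddCommGroup Y] [InnerProductSpace ℝ Y]

/-- Weak convergence in a Hilbert space along a filter. -/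
def WeakTendsto (x : ι → X) (l : Filter ι) (y : X) : Prop :=
  ∀ z : X, Tendsto (fun n => ⟪x n, z⟫_ℝ) l (𝓝 ⟪y, z⟫_ℝ)

theorem WeakTendsto.of_tendsto {x : ι → X} {l : Filter ι} {y : X} (h : Tendsto x l (𝓝 y)) :
    WeakTendsto x l y :=
  fun _ => h.inner tendsto_const_nhds

theorem WeakTendsto.add {x x' : ι → X} {l : Filter ι} {y y' : X} (h : WeakTendsto x l y)
    (h' : WeakTendsto x' l y') : WeakTendsto (fun n => x n + x' n) l (y + y') := fun z => by
  simpa only [inner_add_left] using (h z).add (h' z)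

theorem WeakTendsto.map [CompleteSpace X] [CompleteSpace Y] {x : ι → X} {l : Filter ι} {y : X}
    (h : WeakTendsto x l y) (L : X →L[ℝ] Y) : WeakTendsto (fun n => L (x n)) l (L y) :=
  fun z => by simpa only [ContinuousLinearMap.adjoint_inner_right] using h (L.adjoint z)

theorem WeakTendsto.unique {x : ι → X} {l : Filter ι} [l.NeBot] {y y' : X}
    (h : WeakTendsto x l y) (h' : WeakTendsto x l y') : y = y' :=
  ext_inner_right ℝ fun z => tendsto_nhds_unique (h z) (h' z)

/-- Weak lower semicontinuity, from `2⟪x n, y⟫ ≤ ‖x n‖² + ‖y‖²` in the limit. The bounds `k n` may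
vary because the energy bounds depend on `ε`. -/
theorem WeakTendsto.norm_sq_le {x : ι → X} {l : Filter ι} [l.NeBot] {y : X}
    (h : WeakTendsto x l y) {K : ℝ} {k : ι → ℝ} (hk : Tendsto k l (𝓝 K))
    (hx : ∀ n, ‖x n‖ ^ 2 ≤ k n) : ‖y‖ ^ 2 ≤ K := by
  have h1 : ∀ n, 2 * ⟪x n, y⟫_ℝ ≤ k n + ‖y‖ ^ 2 := fun n => by
    nlinarith [real_inner_le_norm (x n) y, sq_nonneg (‖x n‖ - ‖y‖), hx n]
  have h2 := le_of_tendsto_of_tendsto' ((h y).const_mul 2) (hk.add_const (‖y‖ ^ 2)) h1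
  rw [real_inner_self_eq_norm_sq] at h2
  linarith

/-- Bounded scalars converge along an ultrafilter, so every `⟪x n, z⟫` has a limit. The limit is
linear and bounded in `z`, and the Riesz theorem represents it. Neither separability nor a choice of
subsequences is involved. -/
theorem exists_weakTendsto [CompleteSpace X] {x : ι → X} {C : ℝ} (hx : ∀ n, ‖x n‖ ≤ C)
    (𝓤 : Ultrafilter ι) : ∃ y, WeakTendsto x 𝓤 y := by
  have hb : ∀ z n, ‖⟪x n, z⟫_ℝ‖ ≤ C * ‖z‖ := fun z n =>
    (norm_inner_le_norm _ _).trans (mul_le_mul_of_nonneg_right (hx n) (norm_nonneg z))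
  have hlim : ∀ z, ∃ a : ℝ, Tendsto (fun n => ⟪x n, z⟫_ℝ) 𝓤 (𝓝 a) := fun z => by
    obtain ⟨a, -, ha⟩ := (isCompact_closedBall (0 : ℝ) (C * ‖z‖)).ultrafilter_le_nhds
      (𝓤.map fun n => ⟪x n, z⟫_ℝ) (by
        rw [le_principal_iff, Ultrafilter.mem_coe, Ultrafilter.mem_map]
        refine univ_mem' fun n => ?_
        simpa using hb z n)
    exact ⟨a, ha⟩
  choose a ha using hlim
  let φ : X →L[ℝ] ℝ := LinearMap.mkContinuous
    { toFun := a
      map_add' := fun z z' => tendsto_nhds_unique (ha (z + z'))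
        (by simpa only [inner_add_right] using (ha z).add (ha z'))
      map_smul' := fun c z => tendsto_nhds_unique (ha (c • z))
        (by simpa only [real_inner_smul_right, RingHom.id_apply, smul_eq_mul] using (ha z).const_mul c) }
    C fun z => le_of_tendsto (ha z).norm (Eventually.of_forall (hb z))
  refine ⟨(InnerProductSpace.toDual ℝ X).symm φ, fun z => ?_⟩
  rw [InnerProductSpace.toDual_symm_apply]
  exact ha z

end WeakLimits

/-! ### The Hilbert space `V`, its norm and the tip value. -/

section CantileverSpace

theorem norm_primL_le {E : Type*} [NormedAddCommGroup E] [NormedSpace ℝ E] {b : ℝ} (hb : 0 ≤ b)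
    (f : Lp E 2 (ivl 0 b)) : ‖primL hb f‖ ≤ b * ‖f‖ := by
  -- The pointwise bound `√b ‖f‖` is multiplied by the square root of the measure, which is again
  -- `√b`.
  have h1 : ‖primL hb f‖ ≤ (measureUnivNNReal (ivl 0 b) ^ (ENNReal.toReal 2)⁻¹ * √b) * ‖f‖ :=
    (ContinuousLinearMap.le_opNorm _ _).trans (mul_le_mul_of_nonneg_right
      (LinearMap.mkContinuous_norm_le _ (by positivity) _) (norm_nonneg _))
  have h2 : ((measureUnivNNReal (ivl 0 b) : NNReal) : ℝ) = b := by
    rw [measureUnivNNReal, Measure.restrict_apply_univ, Real.volume_Ioo, sub_zero]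
    exact ENNReal.toReal_ofReal hb
  rw [h2, ENNReal.toReal_ofNat, ← one_div, ← Real.sqrt_eq_rpow, Real.mul_self_sqrt hb] at h1
  exact h1

variable {ℓ : ℝ}

/-- Replaces weak derivatives and boundary values by equations between bounded operators, from which
closedness of `V` is immediate. -/
theorem mem_cantileverSpace_iff (hℓ : 0 < ℓ) (v : PiLp 2 (fun _ : Fin 3 => L2 ℓ)) :
    v ∈ cantileverSpace ℓ ↔ v 0 = primL hℓ.le (v 1) ∧ v 1 = primL hℓ.le (v 2) := by
  have key : ∀ f f' : L2 ℓ, f = primL hℓ.le f' ↔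
      HasWeakDeriv 0 ℓ (f : ℝ → ℝ) f' ∧ HasValueAt 0 ℓ (f : ℝ → ℝ) 0 0 := fun f f' => by
    rw [hasWeakDeriv_and_hasValueAt_iff hℓ (Lp.memLp f) (Lp.memLp f'),
      ← eq_constLp_add_primL_iff hℓ.le]
    simp [constLp]
  rw [key, key]
  constructor
  · rintro ⟨h1, h2, h3, h4⟩
    exact ⟨⟨h1, h3⟩, h2, h4⟩
  · rintro ⟨⟨h1, h3⟩, h2, h4⟩
    exact ⟨h1, h2, h3, h4⟩

theorem completeSpace_V (hℓ : 0 < ℓ) : CompleteSpace (V ℓ) := by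
  have : IsClosed (cantileverSpace ℓ : Set (PiLp 2 (fun _ : Fin 3 => L2 ℓ))) := by
    have e : (cantileverSpace ℓ : Set (PiLp 2 (fun _ : Fin 3 => L2 ℓ))) =
        {v | v 0 = primL hℓ.le (v 1)} ∩ {v | v 1 = primL hℓ.le (v 2)} :=
      Set.ext fun v => mem_cantileverSpace_iff hℓ v
    have c : ∀ i, Continuous fun v : PiLp 2 (fun _ : Fin 3 => L2 ℓ) => v i :=
      fun i => PiLp.continuous_apply 2 _ i
    rw [e]
    exact (isClosed_eq (c 0) ((primL hℓ.le).continuous.comp (c 1))).inter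
      (isClosed_eq (c 1) ((primL hℓ.le).continuous.comp (c 2)))
  exact this.completeSpace_coe

/-- The inclusion of `V` into `L²(0, ℓ)`. -/
def fnL (ℓ : ℝ) : V ℓ →L[ℝ] L2 ℓ :=
  (PiLp.proj 2 (𝕜 := ℝ) (fun _ : Fin 3 => L2 ℓ) 0).comp (cantileverSpace ℓ).subtypeL

/-- The first derivative, as an operator from `V` to `L²(0, ℓ)`. -/
def dxL (ℓ : ℝ) : V ℓ →L[ℝ] L2 ℓ :=
  (PiLp.proj 2 (𝕜 := ℝ) (fun _ : Fin 3 => L2 ℓ) 1).comp (cantileverSpace ℓ).subtypeL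

/-- The second derivative, as an operator from `V` to `L²(0, ℓ)`. -/
def dxxL (ℓ : ℝ) : V ℓ →L[ℝ] L2 ℓ :=
  (PiLp.proj 2 (𝕜 := ℝ) (fun _ : Fin 3 => L2 ℓ) 2).comp (cantileverSpace ℓ).subtypeL

@[simp] theorem fnL_apply (v : V ℓ) : fnL ℓ v = v.fn := rfl
@[simp] theorem dxxL_apply (v : V ℓ) : dxxL ℓ v = v.dxx := rfl

theorem V.fn_eq (hℓ : 0 < ℓ) (v : V ℓ) : v.fn = primL hℓ.le v.dx :=
  ((mem_cantileverSpace_iff hℓ v.1).1 v.2).1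

theorem V.dx_eq (hℓ : 0 < ℓ) (v : V ℓ) : v.dx = primL hℓ.le v.dxx :=
  ((mem_cantileverSpace_iff hℓ v.1).1 v.2).2

/-- Integrating twice from the clamped end gives the factor `1 + ℓ² + ℓ⁴`, which is at most `C*`. -/
theorem V.norm_sq_le (hℓ : 0 < ℓ) (v : V ℓ) : ‖v‖ ^ 2 ≤ Cstar ℓ * ‖v.dxx‖ ^ 2 := by
  have h1 : ‖v.fn‖ ≤ ℓ * ‖v.dx‖ := by
    rw [v.fn_eq hℓ]; exact norm_primL_le hℓ.le _
  have h2 : ‖v.dx‖ ≤ ℓ * ‖v.dxx‖ := by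
    rw [v.dx_eq hℓ]; exact norm_primL_le hℓ.le _
  have h3 := pow_le_pow_left₀ (norm_nonneg _) h1 2
  have h4 := pow_le_pow_left₀ (norm_nonneg _) h2 2
  rw [mul_pow] at h3 h4
  have h5 := mul_le_mul_of_nonneg_left h4 (sq_nonneg ℓ)
  rw [V.norm_sq, Cstar]
  nlinarith [mul_nonneg (sq_nonneg ℓ) (sq_nonneg ‖v.dxx‖),
    mul_nonneg (sq_nonneg (ℓ ^ 2)) (sq_nonneg ‖v.dxx‖)]

/-- Weak derivatives are unique, so the first component determines the triple. This lifts identities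
from `L²(0, ℓ)` to `V`. -/
theorem fnL_injective (ℓ : ℝ) : Function.Injective (fnL ℓ) := by
  intro v w h
  have h0 : v.1 0 = w.1 0 := h
  have h1 : v.1 1 = w.1 1 := by
    refine Lp.ext (HasWeakDeriv.unique v.2.1 ?_ (Lp.memLp _) (Lp.memLp _))
    rw [h0]; exact w.2.1
  have h2 : v.1 2 = w.1 2 := by
    refine Lp.ext (HasWeakDeriv.unique v.2.2.1 ?_ (Lp.memLp _) (Lp.memLp _))
    rw [h1]; exact w.2.2.1
  apply Subtype.ext
  ext1 i
  fin_cases i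
  exacts [h0, h1, h2]

/-- Evaluation at the free end `x = ℓ`. -/
def tip (hℓ : 0 < ℓ) : V ℓ →L[ℝ] ℝ := (primEval hℓ.le hℓ.le).comp (dxL ℓ)

theorem rep_eq_tip (hℓ : 0 < ℓ) (v : V ℓ) : v.rep ℓ = tip hℓ v := by
  obtain ⟨h1, h2⟩ := v.rep_spec
  have h3 : (v.fn : ℝ → ℝ) =ᵐ[ivl 0 ℓ] prim ℓ v.dx := by
    rw [v.fn_eq hℓ]; exact coeFn_primL hℓ.le _
  exact eqOn_Icc_of_ae_eq hℓ h1 (continuous_prim (Lp.integrable_ivl v.dx)).continuousOn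
    (h2.symm.trans h3) (right_mem_Icc.2 hℓ.le)

/-- Two integrations from the clamped end give `v(ℓ) = ∫ (ℓ - s) v_xx(s) ds`. Cauchy–Schwarz
applies, and `∫ (s - ℓ)² = ℓ³/3`. -/
theorem tip_sq_le (hℓ : 0 < ℓ) (v : V ℓ) : tip hℓ v ^ 2 ≤ ℓ ^ 3 / 3 * ‖v.dxx‖ ^ 2 := by
  have hm : MemLp (fun s : ℝ => s - ℓ) 2 (ivl 0 ℓ) := by
    refine MemLp.of_bound (by fun_prop) ℓ ?_
    filter_upwards [ae_restrict_mem measurableSet_Ioo] with x hx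
    rw [Real.norm_eq_abs, abs_le]
    constructor <;> linarith [hx.1, hx.2]
  have h1 : tip hℓ v = - ⟪v.dxx, hm.toLp⟫_ℝ := by
    change prim ℓ v.dx ℓ = _
    have e1 : prim ℓ v.dx ℓ = ∫ s in (0 : ℝ)..ℓ, prim ℓ v.dxx s := by
      have : prim ℓ (v.dx : ℝ → ℝ) = prim ℓ (prim ℓ v.dxx) := by
        refine prim_congr ?_
        conv_lhs => rw [v.dx_eq hℓ]
        exact coeFn_primL hℓ.le _
      rw [this, prim_eq_intervalIntegral (right_mem_Icc.2 hℓ.le)]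
    have e2 := prim_parts_real (b := ℓ) (φ := fun s => s - ℓ) (Lp.integrable_ivl v.dxx)
      (by fun_prop) ℓ
    simp only [deriv_sub_const, deriv_id'', one_mul, sub_self, zero_mul, zero_sub] at e2
    rw [e1, e2, L2.inner_def, integral_ivl_eq hℓ.le, neg_inj]
    refine intervalIntegral.integral_congr_ae ?_
    have hne : ∀ᵐ x : ℝ, x ≠ ℓ := by simp [ae_iff]
    filter_upwards [hne, (ae_restrict_iff' measurableSet_Ioo).1 hm.coeFn_toLp] with x hx h2 h3
    rw [uIoc_of_le hℓ.le] at h3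
    have hx' : x ∈ Ioo 0 ℓ := ⟨h3.1, lt_of_le_of_ne h3.2 hx⟩
    rw [h2 hx', indicator_of_mem hx']
    simp
  have h2 : ‖hm.toLp‖ ^ 2 = ℓ ^ 3 / 3 := by
    rw [← real_inner_self_eq_norm_sq, L2.inner_def]
    have : ∫ s, ⟪(hm.toLp _ : L2 ℓ) s, (hm.toLp _ : L2 ℓ) s⟫_ℝ ∂(ivl 0 ℓ) = ∫ s, (s - ℓ) ^ 2 ∂(ivl 0 ℓ) := by
      refine integral_congr_ae ?_
      filter_upwards [hm.coeFn_toLp] with s hs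
      rw [hs]
      simp
    rw [this, integral_ivl_eq hℓ.le, intervalIntegral.integral_comp_sub_right (fun x => x ^ 2) ℓ,
      integral_pow]
    ring
  rw [h1, neg_sq, ← h2, mul_comm, ← mul_pow]
  exact sq_le_sq' (neg_le_of_abs_le (abs_real_inner_le_norm _ _)) (real_inner_le_norm _ _)

end CantileverSpace

/-! ### Coefficients as symmetric multiplication operators. -/

section Multiplication

variable {ℓ : ℝ} {a : ℝ → ℝ} {C : ℝ}

theorem memLp_mul_bdd (ha : AEStronglyMeasurable a (ivl 0 ℓ)) (hC : ∀ᵐ x ∂(ivl 0 ℓ), |a x| ≤ C)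
    (f : L2 ℓ) : MemLp (fun x => a x * f x) 2 (ivl 0 ℓ) :=
  (Lp.memLp f).of_le_mul (c := C) (ha.mul (Lp.aestronglyMeasurable f)) (by
    filter_upwards [hC] with x hx
    rw [norm_mul]
    exact mul_le_mul_of_nonneg_right hx (norm_nonneg _))

/-- Multiplication by a bounded coefficient, as an operator on `L²(0, ℓ)`. -/
def mulL (ha : AEStronglyMeasurable a (ivl 0 ℓ)) (hC : ∀ᵐ x ∂(ivl 0 ℓ), |a x| ≤ C) :
    L2 ℓ →L[ℝ] L2 ℓ :=
  LinearMap.mkContinuous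
    { toFun := fun f => (memLp_mul_bdd ha hC f).toLp
      map_add' := fun f h => by
        rw [← MemLp.toLp_add]
        refine MemLp.toLp_congr _ _ ?_
        filter_upwards [Lp.coeFn_add f h] with x hx
        rw [hx, Pi.add_apply, Pi.add_apply, mul_add]
      map_smul' := fun c f => by
        rw [RingHom.id_apply, ← MemLp.toLp_const_smul]
        refine MemLp.toLp_congr _ _ ?_
        filter_upwards [Lp.coeFn_smul c f] with x hx
        rw [hx, Pi.smul_apply, Pi.smul_apply, smul_eq_mul, smul_eq_mul, mul_left_comm] }
    C fun f => by
      refine Lp.norm_le_mul_norm_of_ae_le_mul ?_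
      filter_upwards [(memLp_mul_bdd ha hC f).coeFn_toLp, hC] with x h1 h2
      refine (congrArg norm h1).le.trans ?_
      rw [norm_mul]
      exact mul_le_mul_of_nonneg_right h2 (norm_nonneg _)

theorem coeFn_mulL (ha : AEStronglyMeasurable a (ivl 0 ℓ)) (hC : ∀ᵐ x ∂(ivl 0 ℓ), |a x| ≤ C)
    (f : L2 ℓ) : mulL ha hC f =ᵐ[ivl 0 ℓ] fun x => a x * f x :=
  (memLp_mul_bdd ha hC f).coeFn_toLp

theorem norm_mulL_le (ha : AEStronglyMeasurable a (ivl 0 ℓ)) (hC : ∀ᵐ x ∂(ivl 0 ℓ), |a x| ≤ C)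
    (f : L2 ℓ) : ‖mulL ha hC f‖ ≤ C * ‖f‖ := by
  refine Lp.norm_le_mul_norm_of_ae_le_mul ?_
  filter_upwards [coeFn_mulL ha hC f, hC] with x h1 h2
  rw [h1, norm_mul]
  exact mul_le_mul_of_nonneg_right h2 (norm_nonneg _)

theorem inner_mulL (ha : AEStronglyMeasurable a (ivl 0 ℓ)) (hC : ∀ᵐ x ∂(ivl 0 ℓ), |a x| ≤ C)
    (f h : L2 ℓ) : ⟪mulL ha hC f, h⟫_ℝ = ∫ x, a x * f x * h x ∂(ivl 0 ℓ) := by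
  rw [L2.inner_def]
  refine integral_congr_ae ?_
  filter_upwards [coeFn_mulL ha hC f] with x hx
  rw [hx]
  simp [mul_comm]

theorem inner_mulL_comm (ha : AEStronglyMeasurable a (ivl 0 ℓ))
    (hC : ∀ᵐ x ∂(ivl 0 ℓ), |a x| ≤ C) (f h : L2 ℓ) :
    ⟪mulL ha hC f, h⟫_ℝ = ⟪f, mulL ha hC h⟫_ℝ := by
  rw [real_inner_comm (mulL ha hC h), inner_mulL, inner_mulL]
  exact integral_congr_ae (Eventually.of_forall fun x => by ring)

theorem le_inner_mulL (ha : AEStronglyMeasurable a (ivl 0 ℓ)) (hC : ∀ᵐ x ∂(ivl 0 ℓ), |a x| ≤ C)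
    {c : ℝ} (hc : ∀ᵐ x ∂(ivl 0 ℓ), c ≤ a x) (f : L2 ℓ) : c * ‖f‖ ^ 2 ≤ ⟪mulL ha hC f, f⟫_ℝ := by
  rw [← real_inner_self_eq_norm_sq, ← real_inner_smul_left, L2.inner_def, L2.inner_def]
  refine integral_mono_ae (L2.integrable_inner _ _) (L2.integrable_inner _ _) ?_
  filter_upwards [coeFn_mulL ha hC f, hc, Lp.coeFn_smul c f] with x h1 h2 h3
  rw [h1, h3]
  simp only [Pi.smul_apply, smul_eq_mul, RCLike.inner_apply, conj_trivial]
  nlinarith [mul_self_nonneg (f x)]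

end Multiplication

/-! ### Linear ODEs, Gronwall's inequality and the load term. -/

section LinearODE

/-- Variation of constants with the operator exponential. -/
theorem exists_linear_ode {X : Type*} [NormedAddCommGroup X] [NormedSpace ℝ X] [CompleteSpace X]
    (B : X →L[ℝ] X) {f : ℝ → X} (hf : Continuous f) (x₀ : X) :
    ∃ x : ℝ → X, x 0 = x₀ ∧ ∀ t, HasDerivAt x (B (x t) + f t) t := by
  have hneg : ∀ s : ℝ, HasDerivAt (fun t : ℝ => NormedSpace.exp ((-t) • B))
      (-(NormedSpace.exp ((-s) • B) * B)) s := fun s => by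
    have := (hasDerivAt_exp_smul_const B (-s)).scomp s (hasDerivAt_neg s)
    simpa [Function.comp_def] using this
  have hcont : Continuous fun s : ℝ => NormedSpace.exp ((-s) • B) (f s) :=
    (continuous_iff_continuousAt.2 fun s => (hneg s).continuousAt).clm_apply hf
  have hinv : ∀ t : ℝ, NormedSpace.exp (t • B) * NormedSpace.exp ((-t) • B) = 1 := fun t => by
    let _ := NormedAlgebra.restrictScalars ℚ ℝ (X →L[ℝ] X)
    rw [← NormedSpace.exp_add_of_commute]
    · simp
    · exact ((Commute.refl B).smul_left t).smul_right (-t)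
  refine ⟨fun t => NormedSpace.exp (t • B)
    (x₀ + ∫ s in (0 : ℝ)..t, NormedSpace.exp ((-s) • B) (f s)), by simp, fun t => ?_⟩
  have h1 := (intervalIntegral.integral_hasDerivAt_right (hcont.intervalIntegrable 0 t)
    (hcont.stronglyMeasurableAtFilter _ _) hcont.continuousAt).const_add x₀
  have h2 := (hasDerivAt_exp_smul_const' B t).clm_apply h1
  convert h2 using 1
  rw [mul_apply_eq_comp]
  congr 1
  rw [← mul_apply_eq_comp, hinv, one_apply_eq_self]

/-- Gronwall's inequality for the integral: with `Y = ∫ y`, the hypothesis says that `exp (-s) (Y s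
+ R)` has nonpositive derivative. -/
theorem integral_le_of_le_add_integral {T R : ℝ} {y : ℝ → ℝ} (hy : Continuous y)
    (h : ∀ t ∈ Icc 0 T, y t ≤ R + ∫ s in (0 : ℝ)..t, y s) {t : ℝ} (ht : t ∈ Icc 0 T) :
    ∫ s in (0 : ℝ)..t, y s ≤ R * (Real.exp t - 1) := by
  set Y : ℝ → ℝ := fun t => ∫ s in (0 : ℝ)..t, y s with hY
  have hd : ∀ s, HasDerivAt Y (y s) s := fun s =>
    intervalIntegral.integral_hasDerivAt_right (hy.intervalIntegrable 0 s)
      (hy.stronglyMeasurableAtFilter _ _) hy.continuousAt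
  have he : ∀ s, HasDerivAt (fun s => Real.exp (-s) * (Y s + R))
      (Real.exp (-s) * (-1) * (Y s + R) + Real.exp (-s) * y s) s := fun s =>
    ((hasDerivAt_neg s).exp).mul ((hd s).add_const R)
  have hanti : AntitoneOn (fun s => Real.exp (-s) * (Y s + R)) (Icc 0 T) := by
    refine antitoneOn_of_deriv_nonpos (convex_Icc 0 T)
      (fun s _ => (he s).continuousAt.continuousWithinAt)
      (fun s _ => (he s).differentiableAt.differentiableWithinAt) fun s hs => ?_
    rw [interior_Icc] at hs
    rw [(he s).deriv]
    have := h s ⟨hs.1.le, hs.2.le⟩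
    nlinarith [Real.exp_pos (-s)]
  have h0 := hanti (left_mem_Icc.2 (ht.1.trans ht.2)) ht ht.1
  have hz : Y 0 = 0 := by simp [hY]
  simp only [hz, neg_zero, Real.exp_zero, one_mul, zero_add] at h0
  rw [Real.exp_neg, inv_mul_le_iff₀ (Real.exp_pos t)] at h0
  change Y t ≤ _
  linarith

/-- Weighted Young inequality, from `(2δa - Lb)² ≥ 0`. -/
theorem mul_le_of_sq_le {L N δ a : ℝ} (b : ℝ) (hL : 0 < L) (hδ : 0 < δ) (h : a ^ 2 ≤ L * N) :
    a * b ≤ δ * N + L / (4 * δ) * b ^ 2 := by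
  have h1 : 0 ≤ (2 * δ * a - L * b) ^ 2 / (4 * δ * L) := by positivity
  have h2 : (2 * δ * a - L * b) ^ 2 / (4 * δ * L)
      = δ * (a ^ 2 / L) + L / (4 * δ) * b ^ 2 - a * b := by field_simp; ring
  have h3 : a ^ 2 / L ≤ N := by rwa [div_le_iff₀' hL]
  nlinarith

/-- Integration by parts of the load against a function controlled by an energy `n`. -/
theorem integral_deriv_mul_prim_le {T L δ₁ δ₂ : ℝ} (dg : Lp ℝ 2 (ivl 0 T)) {φ n : ℝ → ℝ}
    (hφ : ContDiff ℝ 1 φ) (hn : Continuous n) (hφn : ∀ t, φ t ^ 2 ≤ L * n t)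
    (hL : 0 < L) (h₁ : 0 < δ₁) (h₂ : 0 < δ₂) {t : ℝ} (ht : t ∈ Icc 0 T) :
    ∫ s in (0 : ℝ)..t, deriv φ s * prim T dg s ≤ δ₁ * n t + L * T / (4 * δ₁) * ‖dg‖ ^ 2
      + (δ₂ * (∫ s in (0 : ℝ)..t, n s) + L / (4 * δ₂) * ‖dg‖ ^ 2) := by
  have hT : 0 ≤ T := ht.1.trans ht.2
  have hi := integrable_indicator_of_ivl (Lp.integrable_ivl dg)
  rw [prim_parts_real (Lp.integrable_ivl dg) hφ t]
  -- Boundary term at `t`; the one at `0` vanishes with the primitive.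
  have a1 : φ t * prim T dg t ≤ δ₁ * n t + L * T / (4 * δ₁) * ‖dg‖ ^ 2 := by
    have h := mul_le_of_sq_le (prim T dg t) hL h₁ (hφn t)
    have h' : prim T dg t ^ 2 ≤ T * ‖dg‖ ^ 2 := by
      have := pow_le_pow_left₀ (norm_nonneg _) (norm_prim_Lp_le hT ht.1 dg) 2
      rwa [mul_pow, Real.sq_sqrt hT, Real.norm_eq_abs, sq_abs] at this
    have h'' := mul_le_mul_of_nonneg_left h' (show 0 ≤ L / (4 * δ₁) by positivity)
    calc _ ≤ _ := h
      _ ≤ δ₁ * n t + L / (4 * δ₁) * (T * ‖dg‖ ^ 2) := by linarith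
      _ = _ := by ring
  have hsq : Integrable (fun s => (Ioo 0 T).indicator dg s ^ 2) := by
    have : (fun s => (Ioo 0 T).indicator dg s ^ 2)
        = (Ioo 0 T).indicator fun s => dg s ^ 2 := by
      funext s
      by_cases h : s ∈ Ioo 0 T <;> simp [h]
    rw [this]
    exact integrable_indicator_of_ivl (Lp.memLp dg).integrable_sq
  have hsq' : ∫ s in (0 : ℝ)..t, (Ioo 0 T).indicator dg s ^ 2 ≤ ‖dg‖ ^ 2 := by
    rw [intervalIntegral.integral_of_le ht.1]
    refine (setIntegral_le_integral hsq (Eventually.of_forall fun s => sq_nonneg _)).trans ?_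
    rw [← real_inner_self_eq_norm_sq, L2.inner_def, ← integral_indicator measurableSet_Ioo]
    refine (integral_congr_ae (Eventually.of_forall fun s => ?_)).le
    by_cases h : s ∈ Ioo 0 T <;> simp [h]
  have a2 : -∫ s in (0 : ℝ)..t, φ s * (Ioo 0 T).indicator dg s
      ≤ δ₂ * (∫ s in (0 : ℝ)..t, n s) + L / (4 * δ₂) * ‖dg‖ ^ 2 := by
    have h1 : -∫ s in (0 : ℝ)..t, φ s * (Ioo 0 T).indicator dg s
        ≤ ∫ s in (0 : ℝ)..t, (δ₂ * n s + L / (4 * δ₂) * (Ioo 0 T).indicator dg s ^ 2) := by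
      rw [← intervalIntegral.integral_neg]
      refine intervalIntegral.integral_mono_on ht.1 ?_ ?_ fun s _ => ?_
      · exact (hi.intervalIntegrable.continuousOn_mul hφ.continuous.continuousOn).neg
      · exact ((hn.intervalIntegrable _ _).const_mul _).add (hsq.intervalIntegrable.const_mul _)
      · have := mul_le_of_sq_le (-(Ioo 0 T).indicator dg s) hL h₂ (hφn s)
        rwa [neg_sq, mul_neg] at this
    rw [intervalIntegral.integral_add ((hn.intervalIntegrable _ _).const_mul _)
      (hsq.intervalIntegrable.const_mul _), intervalIntegral.integral_const_mul,
      intervalIntegral.integral_const_mul] at h1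
    have := mul_le_mul_of_nonneg_left hsq' (show 0 ≤ L / (4 * δ₂) by positivity)
    linarith
  linarith

end LinearODE

/-- The data of an abstract second order evolution equation
`⟪ρ (j u)'', j v⟫ + ⟪μ (j u)', j v⟫ + ⟪r D u, D v⟫ + ⟪κ D u', D v⟫ = g β(v)`
on a Hilbert space `V` that is mapped into a Hilbert space `H`. -/
structure DampedSystem (V H : Type*) [NormedAddCommGroup V] [InnerProductSpace ℝ V]
    [NormedAddCommGroup H] [InnerProductSpace ℝ H] where
  j : V →L[ℝ] H
  D : V →L[ℝ] H
  β : V →L[ℝ] ℝ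
  ρ : H →L[ℝ] H
  μ : H →L[ℝ] H
  r : H →L[ℝ] H
  κ : H →L[ℝ] H
  (ρ₀ ρ₁ μ₁ r₀ r₁ κ₀ κ₁ L K : ℝ)
  j_injective : Function.Injective j
  norm_sq_le : ∀ v, ‖v‖ ^ 2 ≤ K * ‖D v‖ ^ 2
  β_sq_le : ∀ v, β v ^ 2 ≤ L * ‖D v‖ ^ 2
  L_pos : 0 < L
  ρ₀_pos : 0 < ρ₀
  r₀_pos : 0 < r₀
  κ₀_pos : 0 < κ₀
  r₁_nonneg : 0 ≤ r₁
  ρ_comm : ∀ x y, ⟪ρ x, y⟫_ℝ = ⟪x, ρ y⟫_ℝ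
  μ_comm : ∀ x y, ⟪μ x, y⟫_ℝ = ⟪x, μ y⟫_ℝ
  r_comm : ∀ x y, ⟪r x, y⟫_ℝ = ⟪x, r y⟫_ℝ
  κ_comm : ∀ x y, ⟪κ x, y⟫_ℝ = ⟪x, κ y⟫_ℝ
  le_ρ : ∀ x, ρ₀ * ‖x‖ ^ 2 ≤ ⟪ρ x, x⟫_ℝ
  ρ_le : ∀ x, ⟪ρ x, x⟫_ℝ ≤ ρ₁ * ‖x‖ ^ 2
  le_μ : ∀ x, 0 ≤ ⟪μ x, x⟫_ℝ
  μ_le : ∀ x, ⟪μ x, x⟫_ℝ ≤ μ₁ * ‖x‖ ^ 2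
  le_r : ∀ x, r₀ * ‖x‖ ^ 2 ≤ ⟪r x, x⟫_ℝ
  norm_r_le : ∀ x, ‖r x‖ ≤ r₁ * ‖x‖
  le_κ : ∀ x, κ₀ * ‖x‖ ^ 2 ≤ ⟪κ x, x⟫_ℝ
  κ_le : ∀ x, ⟪κ x, x⟫_ℝ ≤ κ₁ * ‖x‖ ^ 2

/-! ### The regularized evolution equation. -/

namespace DampedSystem

variable {V H : Type*} [NormedAddCommGroup V] [InnerProductSpace ℝ V]
  [NormedAddCommGroup H] [InnerProductSpace ℝ H] (S : DampedSystem V H)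

/-- Solutions, smooth in time, of the system whose mass form is regularized by `ε ⟪·, ·⟫`. -/
structure IsRegularized (ε : ℝ) (g : ℝ → ℝ) (u₀ v₀ : V) (u w z : ℝ → V) : Prop where
  u_zero : u 0 = u₀
  w_zero : w 0 = v₀
  hasDerivAt_u : ∀ t, HasDerivAt u (w t) t
  hasDerivAt_w : ∀ t, HasDerivAt w (z t) t
  continuous_z : Continuous z
  equation : ∀ t v, ⟪S.ρ (S.j (z t)), S.j v⟫_ℝ + ε * ⟪z t, v⟫_ℝ + ⟪S.μ (S.j (w t)), S.j v⟫_ℝ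
    + ⟪S.r (S.D (u t)), S.D v⟫_ℝ + ⟪S.κ (S.D (w t)), S.D v⟫_ℝ = g t * S.β v

/-- The operator `M` of the regularized mass form is coercive with constant `ε`, hence invertible on
`V` by Lax–Milgram. Solving for the acceleration leaves a first order system for `(u, u')` with a
bounded generator. -/
theorem exists_isRegularized [CompleteSpace V] [CompleteSpace H] {ε : ℝ} (hε : 0 < ε) {g : ℝ → ℝ}
    (hg : Continuous g) (u₀ v₀ : V) : ∃ u w z, S.IsRegularized ε g u₀ v₀ u w z := by
  let ip : V →L[ℝ] V →L[ℝ] ℝ := innerSL ℝ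
  let M : V →L[ℝ] V := S.j.adjoint ∘L S.ρ ∘L S.j + ε • ContinuousLinearMap.id ℝ V
  have hM : ∀ v w, ⟪M v, w⟫_ℝ = ⟪S.ρ (S.j v), S.j w⟫_ℝ + ε * ⟪v, w⟫_ℝ := fun v w => by
    simp [M, inner_add_left, ContinuousLinearMap.adjoint_inner_left, real_inner_smul_left]
  let B : V →L[ℝ] V →L[ℝ] ℝ := ip ∘L M
  have hB : IsCoercive B := ⟨ε, hε, fun v => by
    change _ ≤ ⟪M v, v⟫_ℝ
    rw [hM, real_inner_self_eq_norm_sq]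
    have := S.le_ρ (S.j v)
    nlinarith [mul_nonneg S.ρ₀_pos.le (sq_nonneg ‖S.j v‖)]⟩
  let e := hB.continuousLinearEquivOfBilin
  have he : ∀ v, M (e.symm v) = v := fun v => ext_inner_right ℝ fun w => by
    have := hB.continuousLinearEquivOfBilin_apply (e.symm v) w
    change ⟪e (e.symm v), w⟫_ℝ = ⟪M (e.symm v), w⟫_ℝ at this
    rw [← this, e.apply_symm_apply]
  let b : V := (InnerProductSpace.toDual ℝ V).symm S.β
  let A₁ : V →L[ℝ] V := S.D.adjoint ∘L S.r ∘L S.D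
  let A₂ : V →L[ℝ] V := S.j.adjoint ∘L S.μ ∘L S.j + S.D.adjoint ∘L S.κ ∘L S.D
  let N : V × V →L[ℝ] V × V := (ContinuousLinearMap.snd ℝ V V).prod
    (-((e.symm : V →L[ℝ] V) ∘L
      (A₁ ∘L ContinuousLinearMap.fst ℝ V V + A₂ ∘L ContinuousLinearMap.snd ℝ V V)))
  obtain ⟨x, hx0, hx⟩ := exists_linear_ode N (f := fun t => ((0 : V), g t • e.symm b))
    (continuous_const.prodMk (hg.smul continuous_const)) (u₀, v₀)
  have hxc : Continuous x := continuous_iff_continuousAt.2 fun t => (hx t).continuousAt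
  refine ⟨fun t => (x t).1, fun t => (x t).2, fun t => e.symm (g t • b - A₁ (x t).1 - A₂ (x t).2),
    by simp [hx0], by simp [hx0], fun t => ?_, fun t => ?_, ?_, fun t v => ?_⟩
  · have := (ContinuousLinearMap.fst ℝ V V).hasFDerivAt.comp_hasDerivAt t (hx t)
    simpa [N] using! this
  · have := (ContinuousLinearMap.snd ℝ V V).hasFDerivAt.comp_hasDerivAt t (hx t)
    convert! this using 1
    simp [N, map_sub]
    abel
  · exact e.symm.continuous.comp (((hg.smul continuous_const).sub
      (A₁.continuous.comp hxc.fst)).sub (A₂.continuous.comp hxc.snd))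
  · rw [← hM, he]
    simp [A₁, A₂, inner_sub_left, inner_add_left, ContinuousLinearMap.adjoint_inner_left,
      real_inner_smul_left, b, InnerProductSpace.toDual_symm_apply]
    ring

end DampedSystem

/-! ### Energy estimates with explicit dependence on `ε`. -/

namespace DampedSystem

section Energy

variable {V H : Type*} [NormedAddCommGroup V] [InnerProductSpace ℝ V]
  [NormedAddCommGroup H] [InnerProductSpace ℝ H]

theorem hasDerivAt_inner_clm (A : H →L[ℝ] H) (hA : ∀ x y, ⟪A x, y⟫_ℝ = ⟪x, A y⟫_ℝ) (B : V →L[ℝ] H)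
    {f : ℝ → V} {f' : V} {t : ℝ} (hf : HasDerivAt f f' t) :
    HasDerivAt (fun s => ⟪A (B (f s)), B (f s)⟫_ℝ) (2 * ⟪A (B (f t)), B f'⟫_ℝ) t := by
  have h1 := B.hasFDerivAt.comp_hasDerivAt t hf
  have h2 := A.hasFDerivAt.comp_hasDerivAt t h1
  convert! h2.inner ℝ h1 using 1
  simp only [Function.comp_apply]
  rw [hA (B f'), real_inner_comm _ (B f'), two_mul]

/-- The bound for the energy of the regularized problem. -/
def energyBound (S : DampedSystem V H) (ε T G : ℝ) (u₀ v₀ : V) : ℝ :=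
  2 * (1 + T) * S.L / S.r₀ * G ^ 2 + S.ρ₁ * ‖S.j v₀‖ ^ 2 + S.r₁ * ‖S.D u₀‖ ^ 2 + ε * ‖v₀‖ ^ 2

/-- The bound for the acceleration in the regularized problem. -/
def accelerationBound (S : DampedSystem V H) (ε T G δ : ℝ)
    (u₀ v₀ : V) : ℝ :=
  (4 * S.r₁ ^ 2 / S.r₀ + S.r₁ + δ) * (Real.exp T / S.κ₀) * S.energyBound ε T G u₀ v₀
    + (2 * S.L * T / S.κ₀ + S.L / (2 * δ)) * G ^ 2
    + S.μ₁ * ‖S.j v₀‖ ^ 2 + (S.κ₁ + 1) * ‖S.D v₀‖ ^ 2 + S.r₁ ^ 2 * ‖S.D u₀‖ ^ 2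

theorem r_le (S : DampedSystem V H) (x : H) : ⟪S.r x, x⟫_ℝ ≤ S.r₁ * ‖x‖ ^ 2 := by
  have := mul_le_mul_of_nonneg_right (S.norm_r_le x) (norm_nonneg x)
  nlinarith [real_inner_le_norm (S.r x) x]

namespace IsRegularized

variable {S : DampedSystem V H} {ε T : ℝ} {g : ℝ → ℝ} {u₀ v₀ : V} {u w z : ℝ → V}

theorem continuous_u (h : S.IsRegularized ε g u₀ v₀ u w z) : Continuous u :=
  continuous_iff_continuousAt.2 fun t => (h.hasDerivAt_u t).continuousAt

theorem continuous_w (h : S.IsRegularized ε g u₀ v₀ u w z) : Continuous w :=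
  continuous_iff_continuousAt.2 fun t => (h.hasDerivAt_w t).continuousAt

variable {dg : Lp ℝ 2 (ivl 0 T)}

theorem integral_load_le {f f' : ℝ → V} (hf : ∀ t, HasDerivAt f (f' t) t) (hf' : Continuous f')
    {δ₁ δ₂ : ℝ} (h₁ : 0 < δ₁) (h₂ : 0 < δ₂) {t : ℝ} (ht : t ∈ Icc 0 T) :
    ∫ s in (0 : ℝ)..t, S.β (f' s) * prim T dg s
      ≤ δ₁ * ‖S.D (f t)‖ ^ 2 + S.L * T / (4 * δ₁) * ‖dg‖ ^ 2
      + (δ₂ * (∫ s in (0 : ℝ)..t, ‖S.D (f s)‖ ^ 2) + S.L / (4 * δ₂) * ‖dg‖ ^ 2) := by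
  have hd : ∀ s, HasDerivAt (fun s => S.β (f s)) (S.β (f' s)) s := fun s =>
    S.β.hasFDerivAt.comp_hasDerivAt s (hf s)
  have hd' : deriv (fun s => S.β (f s)) = fun s => S.β (f' s) := funext fun s => (hd s).deriv
  have hc : Continuous f := continuous_iff_continuousAt.2 fun t => (hf t).continuousAt
  have h := integral_deriv_mul_prim_le (L := S.L) dg (φ := fun s => S.β (f s))
    (n := fun s => ‖S.D (f s)‖ ^ 2)
    (contDiff_one_iff_deriv.2 ⟨fun s => (hd s).differentiableAt, by
      rw [hd']; exact S.β.continuous.comp hf'⟩)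
    (by fun_prop) (fun s => S.β_sq_le _) S.L_pos h₁ h₂ ht
  rwa [hd'] at h

/-- The equation is tested with `w = u'`. The `μ` form is dropped and the `κ` form gives the
integral of `‖D w‖²`. -/
theorem energy_le (h : S.IsRegularized ε (prim T dg) u₀ v₀ u w z) (hε : 0 ≤ ε) {t : ℝ}
    (ht : t ∈ Icc 0 T) :
    S.r₀ / 2 * ‖S.D (u t)‖ ^ 2 + 2 * S.κ₀ * ∫ s in (0 : ℝ)..t, ‖S.D (w s)‖ ^ 2
      ≤ S.energyBound ε T ‖dg‖ u₀ v₀ + S.r₀ / 2 * ∫ s in (0 : ℝ)..t, ‖S.D (u s)‖ ^ 2 := by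
  have hu := h.continuous_u
  have hw := h.continuous_w
  have hG : Continuous (prim T (dg : ℝ → ℝ)) := continuous_prim (Lp.integrable_ivl dg)
  have hE : ∀ s, HasDerivAt (fun s => ⟪S.ρ (S.j (w s)), S.j (w s)⟫_ℝ + ε * ‖w s‖ ^ 2
      + ⟪S.r (S.D (u s)), S.D (u s)⟫_ℝ)
      (2 * (S.β (w s) * prim T dg s - ⟪S.μ (S.j (w s)), S.j (w s)⟫_ℝ
        - ⟪S.κ (S.D (w s)), S.D (w s)⟫_ℝ)) s := fun s => by
    refine (((hasDerivAt_inner_clm S.ρ S.ρ_comm S.j (h.hasDerivAt_w s)).add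
      ((h.hasDerivAt_w s).norm_sq.const_mul ε)).add
      (hasDerivAt_inner_clm S.r S.r_comm S.D (h.hasDerivAt_u s))).congr_deriv ?_
    have e := h.equation s (w s)
    rw [S.ρ_comm, real_inner_comm, real_inner_comm (w s)] at e
    linarith
  have hc : Continuous fun s => S.β (w s) * prim T dg s := by fun_prop
  have hP : Continuous fun s => ‖S.D (w s)‖ ^ 2 := by fun_prop
  have hE' : Continuous fun s => 2 * (S.β (w s) * prim T dg s - ⟪S.μ (S.j (w s)), S.j (w s)⟫_ℝ
      - ⟪S.κ (S.D (w s)), S.D (w s)⟫_ℝ) := by fun_prop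
  have h1 := intervalIntegral.integral_eq_sub_of_hasDerivAt (a := 0) (b := t)
    (fun s _ => hE s) (hE'.intervalIntegrable _ _)
  have h2 : ∫ s in (0 : ℝ)..t, 2 * (S.β (w s) * prim T dg s - ⟪S.μ (S.j (w s)), S.j (w s)⟫_ℝ
      - ⟪S.κ (S.D (w s)), S.D (w s)⟫_ℝ)
      ≤ ∫ s in (0 : ℝ)..t, (2 * (S.β (w s) * prim T dg s) - 2 * S.κ₀ * ‖S.D (w s)‖ ^ 2) := by
    refine intervalIntegral.integral_mono_on ht.1 (hE'.intervalIntegrable _ _)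
      (((hc.const_mul 2).sub (hP.const_mul _)).intervalIntegrable _ _) fun s _ => ?_
    linarith [S.le_μ (S.j (w s)), S.le_κ (S.D (w s))]
  rw [intervalIntegral.integral_sub ((hc.const_mul 2).intervalIntegrable _ _)
    ((hP.const_mul _).intervalIntegrable _ _)] at h2
  simp only [intervalIntegral.integral_const_mul] at h1 h2
  have hr := S.r₀_pos
  -- The load enters twice, so the weight `r₀ / 4` consumes half of the coercivity `r₀ ‖D u(t)‖²`
  -- and leaves a Gronwall term with the same factor `r₀ / 2`.
  have h3 := integral_load_le (S := S) (dg := dg) h.hasDerivAt_u hw (δ₁ := S.r₀ / 4)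
    (δ₂ := S.r₀ / 4) (by positivity) (by positivity) ht
  rw [h1, h.u_zero, h.w_zero] at h2
  have e1 : S.L * T / (4 * (S.r₀ / 4)) = S.L * T / S.r₀ := by congr 1; ring
  have e2 : S.L / (4 * (S.r₀ / 4)) = S.L / S.r₀ := by congr 1; ring
  have e3 : 2 * (1 + T) * S.L / S.r₀ = 2 * (S.L * T / S.r₀) + 2 * (S.L / S.r₀) := by ring
  rw [e1, e2] at h3
  rw [energyBound, e3]
  have h4 := S.le_ρ (S.j (w t))
  have h5 := mul_nonneg S.ρ₀_pos.le (sq_nonneg ‖S.j (w t)‖)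
  have h6 := mul_nonneg hε (sq_nonneg ‖w t‖)
  linarith [S.le_r (S.D (u t)), S.ρ_le (S.j v₀), S.r_le (S.D u₀)]

theorem integral_norm_D_u_le (h : S.IsRegularized ε (prim T dg) u₀ v₀ u w z) (hε : 0 ≤ ε) {t : ℝ}
    (ht : t ∈ Icc 0 T) : S.r₀ / 2 * ∫ s in (0 : ℝ)..t, ‖S.D (u s)‖ ^ 2
      ≤ S.energyBound ε T ‖dg‖ u₀ v₀ * (Real.exp t - 1) := by
  have hu := h.continuous_u
  rw [← intervalIntegral.integral_const_mul]
  refine integral_le_of_le_add_integral (T := T) (by fun_prop) (fun t ht => ?_) ht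
  rw [intervalIntegral.integral_const_mul]
  have h1 : 0 ≤ ∫ s in (0 : ℝ)..t, ‖S.D (w s)‖ ^ 2 :=
    intervalIntegral.integral_nonneg ht.1 fun s _ => sq_nonneg _
  have h2 := mul_nonneg (mul_nonneg zero_le_two S.κ₀_pos.le) h1
  linarith [h.energy_le hε ht]

theorem energy_le_exp (h : S.IsRegularized ε (prim T dg) u₀ v₀ u w z) (hε : 0 ≤ ε) {t : ℝ}
    (ht : t ∈ Icc 0 T) :
    S.r₀ / 2 * ‖S.D (u t)‖ ^ 2 + 2 * S.κ₀ * ∫ s in (0 : ℝ)..t, ‖S.D (w s)‖ ^ 2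
      ≤ S.energyBound ε T ‖dg‖ u₀ v₀ * Real.exp t := by
  linarith [h.energy_le hε ht, h.integral_norm_D_u_le hε ht]

theorem energyBound_nonneg (h : S.IsRegularized ε (prim T dg) u₀ v₀ u w z) (hε : 0 ≤ ε)
    (hT : 0 ≤ T) : 0 ≤ S.energyBound ε T ‖dg‖ u₀ v₀ := by
  have h1 := h.energy_le hε (left_mem_Icc.2 hT)
  simp only [intervalIntegral.integral_same, mul_zero, add_zero] at h1
  exact (mul_nonneg (half_pos S.r₀_pos).le (sq_nonneg _)).trans h1

/-- The equation is tested with `z = u''`, and the stiffness term is rewritten as `⟪r D u, D z⟫ =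
d/dt ⟪r D u, D w⟫ - ⟪r D w, D w⟫`. What remains is controlled by the first energy estimate. The term
with `ε` stays on the left, since it later shows that `ε z` tends to zero. -/
theorem integral_acceleration_le (h : S.IsRegularized ε (prim T dg) u₀ v₀ u w z) (hε : 0 ≤ ε)
    (hT : 0 ≤ T) {δ : ℝ} (hδ : 0 < δ) :
    2 * S.ρ₀ * (∫ s in (0 : ℝ)..T, ‖S.j (z s)‖ ^ 2) + 2 * ε * (∫ s in (0 : ℝ)..T, ‖z s‖ ^ 2)
      ≤ S.accelerationBound ε T ‖dg‖ δ u₀ v₀ := by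
  have hu := h.continuous_u
  have hw := h.continuous_w
  have hz := h.continuous_z
  have hG : Continuous (prim T (dg : ℝ → ℝ)) := continuous_prim (Lp.integrable_ivl dg)
  have hTT : T ∈ Icc 0 T := right_mem_Icc.2 hT
  have hE : ∀ s, HasDerivAt (fun s => ⟪S.μ (S.j (w s)), S.j (w s)⟫_ℝ
      + ⟪S.κ (S.D (w s)), S.D (w s)⟫_ℝ + 2 * ⟪S.r (S.D (u s)), S.D (w s)⟫_ℝ)
      (2 * (S.β (z s) * prim T dg s - ⟪S.ρ (S.j (z s)), S.j (z s)⟫_ℝ - ε * ‖z s‖ ^ 2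
        + ⟪S.r (S.D (w s)), S.D (w s)⟫_ℝ)) s := fun s => by
    have hDu := S.r.hasFDerivAt.comp_hasDerivAt s
      (S.D.hasFDerivAt.comp_hasDerivAt s (h.hasDerivAt_u s))
    have hDw := S.D.hasFDerivAt.comp_hasDerivAt s (h.hasDerivAt_w s)
    refine (((hasDerivAt_inner_clm S.μ S.μ_comm S.j (h.hasDerivAt_w s)).add
      (hasDerivAt_inner_clm S.κ S.κ_comm S.D (h.hasDerivAt_w s))).add
      ((hDu.inner ℝ hDw).const_mul 2)).congr_deriv ?_
    have e := h.equation s (z s)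
    rw [real_inner_self_eq_norm_sq] at e
    simp only [Function.comp_apply]
    linarith
  have hc : Continuous fun s => S.β (z s) * prim T dg s := by fun_prop
  have hP : Continuous fun s => ‖S.D (w s)‖ ^ 2 := by fun_prop
  have hQ : Continuous fun s => ‖S.j (z s)‖ ^ 2 := by fun_prop
  have hZ : Continuous fun s => ‖z s‖ ^ 2 := by fun_prop
  have hE' : Continuous fun s => 2 * (S.β (z s) * prim T dg s - ⟪S.ρ (S.j (z s)), S.j (z s)⟫_ℝ
      - ε * ‖z s‖ ^ 2 + ⟪S.r (S.D (w s)), S.D (w s)⟫_ℝ) := by fun_prop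
  have h1 := intervalIntegral.integral_eq_sub_of_hasDerivAt (a := 0) (b := T)
    (fun s _ => hE s) (hE'.intervalIntegrable _ _)
  have h2 : ∫ s in (0 : ℝ)..T, 2 * (S.β (z s) * prim T dg s - ⟪S.ρ (S.j (z s)), S.j (z s)⟫_ℝ
      - ε * ‖z s‖ ^ 2 + ⟪S.r (S.D (w s)), S.D (w s)⟫_ℝ)
      ≤ ∫ s in (0 : ℝ)..T, (2 * (S.β (z s) * prim T dg s) - 2 * S.ρ₀ * ‖S.j (z s)‖ ^ 2
        - 2 * ε * ‖z s‖ ^ 2 + 2 * S.r₁ * ‖S.D (w s)‖ ^ 2) := by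
    refine intervalIntegral.integral_mono_on hT (hE'.intervalIntegrable _ _)
      ((((hc.const_mul 2).sub (hQ.const_mul _)).sub (hZ.const_mul _)).add
        (hP.const_mul _) |>.intervalIntegrable _ _) fun s _ => ?_
    linarith [S.le_ρ (S.j (z s)), S.r_le (S.D (w s))]
  rw [intervalIntegral.integral_add (Continuous.intervalIntegrable (by fun_prop) _ _)
      (Continuous.intervalIntegrable (by fun_prop) _ _),
    intervalIntegral.integral_sub (Continuous.intervalIntegrable (by fun_prop) _ _)
      (Continuous.intervalIntegrable (by fun_prop) _ _),
    intervalIntegral.integral_sub (Continuous.intervalIntegrable (by fun_prop) _ _)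
      (Continuous.intervalIntegrable (by fun_prop) _ _)] at h2
  simp only [intervalIntegral.integral_const_mul] at h2
  have hκ := S.κ₀_pos
  -- Of the coercivity `κ₀ ‖D w(T)‖²`, one half absorbs the load and the other half absorbs the
  -- mixed term in `c1`. The weight `δ` remains free.
  have h3 := integral_load_le (S := S) (dg := dg) h.hasDerivAt_w hz (δ₁ := S.κ₀ / 4)
    (δ₂ := δ) (by positivity) hδ hTT
  rw [intervalIntegral.integral_const_mul] at h1
  rw [h1, h.u_zero, h.w_zero] at h2
  have e1 : S.L * T / (4 * (S.κ₀ / 4)) = S.L * T / S.κ₀ := by congr 1; ring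
  rw [e1] at h3
  have c1 : -(2 * ⟪S.r (S.D (u T)), S.D (w T)⟫_ℝ)
      ≤ S.κ₀ / 2 * ‖S.D (w T)‖ ^ 2 + 2 * S.r₁ ^ 2 / S.κ₀ * ‖S.D (u T)‖ ^ 2 := by
    have a1 := neg_le_of_abs_le (abs_real_inner_le_norm (S.r (S.D (u T))) (S.D (w T)))
    have a2 := mul_le_mul_of_nonneg_right (S.norm_r_le (S.D (u T))) (norm_nonneg (S.D (w T)))
    have a3 : 0 ≤ (S.κ₀ * ‖S.D (w T)‖ - 2 * S.r₁ * ‖S.D (u T)‖) ^ 2 / (2 * S.κ₀) := by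
      positivity
    have a4 : (S.κ₀ * ‖S.D (w T)‖ - 2 * S.r₁ * ‖S.D (u T)‖) ^ 2 / (2 * S.κ₀)
        = S.κ₀ / 2 * ‖S.D (w T)‖ ^ 2 + 2 * S.r₁ ^ 2 / S.κ₀ * ‖S.D (u T)‖ ^ 2
          - 2 * (S.r₁ * ‖S.D (u T)‖ * ‖S.D (w T)‖) := by field_simp; ring
    linarith
  have c2 : 2 * ⟪S.r (S.D u₀), S.D v₀⟫_ℝ ≤ ‖S.D v₀‖ ^ 2 + S.r₁ ^ 2 * ‖S.D u₀‖ ^ 2 := by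
    have a1 := real_inner_le_norm (S.r (S.D u₀)) (S.D v₀)
    have a2 := mul_le_mul_of_nonneg_right (S.norm_r_le (S.D u₀)) (norm_nonneg (S.D v₀))
    nlinarith [sq_nonneg (S.r₁ * ‖S.D u₀‖ - ‖S.D v₀‖)]
  have c3 := h.energy_le_exp hε hTT
  have hN := mul_nonneg (half_pos S.r₀_pos).le (sq_nonneg ‖S.D (u T)‖)
  have hI : 0 ≤ ∫ s in (0 : ℝ)..T, ‖S.D (w s)‖ ^ 2 :=
    intervalIntegral.integral_nonneg hT fun s _ => sq_nonneg _
  have hI' := mul_nonneg (mul_nonneg zero_le_two hκ.le) hI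
  have hr := S.r₀_pos
  set R := S.energyBound ε T ‖dg‖ u₀ v₀ * Real.exp T with hR
  have c4 : 2 * S.r₁ ^ 2 / S.κ₀ * ‖S.D (u T)‖ ^ 2 ≤ 4 * S.r₁ ^ 2 / (S.r₀ * S.κ₀) * R := by
    have : 4 * S.r₁ ^ 2 / (S.r₀ * S.κ₀) * (S.r₀ / 2 * ‖S.D (u T)‖ ^ 2)
      = 2 * S.r₁ ^ 2 / S.κ₀ * ‖S.D (u T)‖ ^ 2 := by field_simp; ring
    rw [← this]
    exact mul_le_mul_of_nonneg_left (by linarith) (by positivity)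
  have c5 : 2 * (S.r₁ + δ) * (∫ s in (0 : ℝ)..T, ‖S.D (w s)‖ ^ 2) ≤ (S.r₁ + δ) / S.κ₀ * R := by
    have : (S.r₁ + δ) / S.κ₀ * (2 * S.κ₀ * ∫ s in (0 : ℝ)..T, ‖S.D (w s)‖ ^ 2)
      = 2 * (S.r₁ + δ) * (∫ s in (0 : ℝ)..T, ‖S.D (w s)‖ ^ 2) := by field_simp
    rw [← this]
    have := S.r₁_nonneg
    exact mul_le_mul_of_nonneg_left (by linarith) (by positivity)
  have e2 : S.accelerationBound ε T ‖dg‖ δ u₀ v₀ = 4 * S.r₁ ^ 2 / (S.r₀ * S.κ₀) * R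
      + (S.r₁ + δ) / S.κ₀ * R + (2 * (S.L * T / S.κ₀) + 2 * (S.L / (4 * δ))) * ‖dg‖ ^ 2
      + S.μ₁ * ‖S.j v₀‖ ^ 2 + (S.κ₁ + 1) * ‖S.D v₀‖ ^ 2 + S.r₁ ^ 2 * ‖S.D u₀‖ ^ 2 := by
    rw [accelerationBound, hR]
    field_simp
    ring
  rw [e2]
  linarith [S.le_μ (S.j (w T)), S.le_κ (S.D (w T)), S.μ_le (S.j v₀), S.κ_le (S.D v₀)]

end IsRegularized

end Energy

end DampedSystem

/-! ### Continuous functions as elements of `L²(0, b)`. -/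

section ContinuousToLp

variable {E : Type*} [NormedAddCommGroup E]

theorem memLp_of_continuous {f : ℝ → E} (hf : Continuous f) (b : ℝ) :
    MemLp f 2 (ivl 0 b) := by
  obtain ⟨C, hC⟩ := (isCompact_Icc (a := (0:ℝ)) (b := b)).exists_bound_of_continuousOn
    hf.continuousOn
  refine MemLp.of_bound hf.aestronglyMeasurable C ?_
  filter_upwards [ae_restrict_mem measurableSet_Ioo] with x hx
  exact hC x ⟨hx.1.le, hx.2.le⟩

theorem norm_sq_eq_integral {b : ℝ} [InnerProductSpace ℝ E] (f : Lp E 2 (ivl 0 b)) :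
    ‖f‖ ^ 2 = ∫ t, ‖f t‖ ^ 2 ∂(ivl 0 b) := by
  simp only [← real_inner_self_eq_norm_sq]
  rw [L2.inner_def]

theorem norm_sq_toLp [InnerProductSpace ℝ E] {f : ℝ → E} (hf : Continuous f) {b : ℝ}
    (hb : 0 ≤ b) : ‖(memLp_of_continuous hf b).toLp‖ ^ 2 = ∫ t in (0 : ℝ)..b, ‖f t‖ ^ 2 := by
  rw [norm_sq_eq_integral, ← integral_ivl_eq hb]
  refine integral_congr_ae ?_
  filter_upwards [(memLp_of_continuous hf b).coeFn_toLp] with t ht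
  rw [ht]

theorem toLp_eq_constLp_add_primL [NormedSpace ℝ E] [CompleteSpace E] {f f' : ℝ → E}
    (hf : ∀ t, HasDerivAt f (f' t) t) (hc : Continuous f) (hf' : Continuous f') {b : ℝ}
    (hb : 0 ≤ b) : (memLp_of_continuous hc b).toLp
      = constLp b (f 0) + primL hb (memLp_of_continuous hf' b).toLp := by
  rw [eq_constLp_add_primL_iff]
  filter_upwards [(memLp_of_continuous hc b).coeFn_toLp, ae_restrict_mem measurableSet_Ioo]
    with t h1 h2
  rw [h1, prim_congr (memLp_of_continuous hf' b).coeFn_toLp,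
    prim_eq_intervalIntegral ⟨h2.1.le, h2.2.le⟩,
    intervalIntegral.integral_eq_sub_of_hasDerivAt (fun s _ => hf s)
      (hf'.intervalIntegrable _ _), add_sub_cancel]

theorem exists_norm_le_of_norm_sq_le {x : ℕ → E} {k : ℕ → ℝ} {a : ℝ} (hx : ∀ n, ‖x n‖ ^ 2 ≤ k n)
    (hk : Tendsto k atTop (𝓝 a)) : ∃ C, ∀ n, ‖x n‖ ≤ C := by
  obtain ⟨C, hC⟩ := hk.bddAbove_range
  exact ⟨√C, fun n => Real.le_sqrt_of_sq_le ((hx n).trans (hC ⟨n, rfl⟩))⟩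

end ContinuousToLp

/-! ### Passage to the limit `ε → 0`. -/

namespace DampedSystem

variable {V H : Type*} [NormedAddCommGroup V] [InnerProductSpace ℝ V] [CompleteSpace V]
  [NormedAddCommGroup H] [InnerProductSpace ℝ H] [CompleteSpace H] (S : DampedSystem V H) {T : ℝ}

/-- Solutions of the abstract evolution equation: `u' = w`, `(j w)' = z`. -/
structure IsSolution (hT : 0 ≤ T) (g : Lp ℝ 2 (ivl 0 T)) (u₀ v₀ : V) (u w : Lp V 2 (ivl 0 T))
    (z : Lp H 2 (ivl 0 T)) : Prop where
  u_eq : u = constLp T u₀ + primL hT w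
  w_eq : S.j.compLpL 2 (ivl 0 T) w = constLp T (S.j v₀) + primL hT z
  equation : ∀ v, ∀ᵐ t ∂(ivl 0 T), ⟪S.ρ (z t), S.j v⟫_ℝ + ⟪S.μ (S.j (w t)), S.j v⟫_ℝ
    + ⟪S.r (S.D (u t)), S.D v⟫_ℝ + ⟪S.κ (S.D (w t)), S.D v⟫_ℝ = g t * S.β v

/-- The left hand side of the equation, tested with `v`, as an element of `L²(0, T)`. -/
def lhs (v : V) (u w : Lp V 2 (ivl 0 T)) (z : Lp H 2 (ivl 0 T)) : Lp ℝ 2 (ivl 0 T) :=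
  (innerSL ℝ (S.ρ (S.j v))).compLpL 2 (ivl 0 T) z
    + (innerSL ℝ (S.μ (S.j v)) ∘L S.j).compLpL 2 (ivl 0 T) w
    + (innerSL ℝ (S.r (S.D v)) ∘L S.D).compLpL 2 (ivl 0 T) u
    + (innerSL ℝ (S.κ (S.D v)) ∘L S.D).compLpL 2 (ivl 0 T) w

theorem coeFn_lhs (v : V) (u w : Lp V 2 (ivl 0 T)) (z : Lp H 2 (ivl 0 T)) :
    S.lhs v u w z =ᵐ[ivl 0 T] fun t => ⟪S.ρ (z t), S.j v⟫_ℝ + ⟪S.μ (S.j (w t)), S.j v⟫_ℝ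
      + ⟪S.r (S.D (u t)), S.D v⟫_ℝ + ⟪S.κ (S.D (w t)), S.D v⟫_ℝ := by
  unfold lhs
  filter_upwards [Lp.coeFn_add ((innerSL ℝ (S.ρ (S.j v))).compLpL 2 (ivl 0 T) z
      + (innerSL ℝ (S.μ (S.j v)) ∘L S.j).compLpL 2 (ivl 0 T) w
      + (innerSL ℝ (S.r (S.D v)) ∘L S.D).compLpL 2 (ivl 0 T) u)
      ((innerSL ℝ (S.κ (S.D v)) ∘L S.D).compLpL 2 (ivl 0 T) w),
    Lp.coeFn_add ((innerSL ℝ (S.ρ (S.j v))).compLpL 2 (ivl 0 T) z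
      + (innerSL ℝ (S.μ (S.j v)) ∘L S.j).compLpL 2 (ivl 0 T) w)
      ((innerSL ℝ (S.r (S.D v)) ∘L S.D).compLpL 2 (ivl 0 T) u),
    Lp.coeFn_add ((innerSL ℝ (S.ρ (S.j v))).compLpL 2 (ivl 0 T) z)
      ((innerSL ℝ (S.μ (S.j v)) ∘L S.j).compLpL 2 (ivl 0 T) w),
    (innerSL ℝ (S.ρ (S.j v))).coeFn_compLpL (p := 2) z,
    (innerSL ℝ (S.μ (S.j v)) ∘L S.j).coeFn_compLpL (p := 2) w,
    (innerSL ℝ (S.r (S.D v)) ∘L S.D).coeFn_compLpL (p := 2) u,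
    (innerSL ℝ (S.κ (S.D v)) ∘L S.D).coeFn_compLpL (p := 2) w] with t h1 h2 h3 h4 h5 h6 h7
  rw [h1, Pi.add_apply, h2, Pi.add_apply, h3, Pi.add_apply, h4, h5, h6, h7]
  simp only [ContinuousLinearMap.comp_apply, innerSL_apply_apply]
  rw [S.ρ_comm, S.μ_comm, S.r_comm, S.κ_comm, real_inner_comm (S.ρ (z t)),
    real_inner_comm (S.μ _), real_inner_comm (S.r _), real_inner_comm (S.κ _)]

/-- Rewrites the equation as an identity in `L²(0, T)` that is linear and continuous in `(u, w, z)`,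
the form in which it survives weak limits and differences. -/
theorem lhs_eq_iff {v : V} {u w : Lp V 2 (ivl 0 T)} {z : Lp H 2 (ivl 0 T)}
    {g : Lp ℝ 2 (ivl 0 T)} : S.lhs v u w z = S.β v • g ↔
      ∀ᵐ t ∂(ivl 0 T), ⟪S.ρ (z t), S.j v⟫_ℝ + ⟪S.μ (S.j (w t)), S.j v⟫_ℝ
      + ⟪S.r (S.D (u t)), S.D v⟫_ℝ + ⟪S.κ (S.D (w t)), S.D v⟫_ℝ = g t * S.β v := by
  constructor
  · intro h
    filter_upwards [S.coeFn_lhs v u w z, Lp.coeFn_smul (S.β v) g] with t h1 h2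
    rw [← h1, h, h2, Pi.smul_apply, smul_eq_mul, mul_comm]
  · intro h
    refine Lp.ext ?_
    filter_upwards [S.coeFn_lhs v u w z, Lp.coeFn_smul (S.β v) g, h] with t h1 h2 h3
    rw [h1, h2, Pi.smul_apply, smul_eq_mul, mul_comm, h3]

theorem weakTendsto_lhs {ι : Type*} {l : Filter ι} (v : V) {u w : ι → Lp V 2 (ivl 0 T)}
    {z : ι → Lp H 2 (ivl 0 T)} {u' w' : Lp V 2 (ivl 0 T)} {z' : Lp H 2 (ivl 0 T)}
    (hu : WeakTendsto u l u') (hw : WeakTendsto w l w') (hz : WeakTendsto z l z') :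
    WeakTendsto (fun n => S.lhs v (u n) (w n) (z n)) l (S.lhs v u' w' z') :=
  (((hz.map _).add (hw.map _)).add (hu.map _)).add (hw.map _)

variable {S} in
theorem IsRegularized.lhs_add {ε : ℝ} {dg : Lp ℝ 2 (ivl 0 T)} {u₀ v₀ : V} {u w z : ℝ → V}
    (h : S.IsRegularized ε (prim T dg) u₀ v₀ u w z) (hT : 0 ≤ T) (v : V) :
    S.lhs v (memLp_of_continuous h.continuous_u T).toLp (memLp_of_continuous h.continuous_w T).toLp
        (S.j.compLpL 2 (ivl 0 T) (memLp_of_continuous h.continuous_z T).toLp)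
      + (innerSL ℝ v).compLpL 2 (ivl 0 T) (ε • (memLp_of_continuous h.continuous_z T).toLp)
      = S.β v • primL hT dg := by
  refine Lp.ext ?_
  set U := (memLp_of_continuous h.continuous_u T).toLp
  set W := (memLp_of_continuous h.continuous_w T).toLp
  set Z := (memLp_of_continuous h.continuous_z T).toLp
  filter_upwards [Lp.coeFn_add (S.lhs v U W (S.j.compLpL 2 (ivl 0 T) Z))
      ((innerSL ℝ v).compLpL 2 (ivl 0 T) (ε • Z)),
    S.coeFn_lhs v U W (S.j.compLpL 2 (ivl 0 T) Z), S.j.coeFn_compLpL (p := 2) Z,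
    (innerSL ℝ v).coeFn_compLpL (p := 2) (ε • Z), Lp.coeFn_smul ε Z,
    (memLp_of_continuous h.continuous_u T).coeFn_toLp,
    (memLp_of_continuous h.continuous_w T).coeFn_toLp,
    (memLp_of_continuous h.continuous_z T).coeFn_toLp,
    Lp.coeFn_smul (S.β v) (primL hT dg), coeFn_primL hT dg]
    with t h1 h2 h3 h4 h5 h6 h7 h8 h9 h10
  rw [h1, Pi.add_apply, h2, h4, h5, Pi.smul_apply, h9, Pi.smul_apply, h10, h3, h6, h7, h8,
    innerSL_apply_apply, real_inner_smul_right, real_inner_comm (z t) v, smul_eq_mul, mul_comm (S.β v),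
    ← h.equation t v]
  ring

theorem tendsto_energyBound (T G : ℝ) (u₀ v₀ : V) {ε : ℕ → ℝ} {l : Filter ℕ}
    (hε : Tendsto ε l (𝓝 0)) :
    Tendsto (fun n => S.energyBound (ε n) T G u₀ v₀) l (𝓝 (S.energyBound 0 T G u₀ v₀)) :=
  (hε.mul_const _).const_add _

theorem tendsto_accelerationBound (T G δ : ℝ) (u₀ v₀ : V) {ε : ℕ → ℝ} {l : Filter ℕ}
    (hε : Tendsto ε l (𝓝 0)) :
    Tendsto (fun n => S.accelerationBound (ε n) T G δ u₀ v₀) l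
      (𝓝 (S.accelerationBound 0 T G δ u₀ v₀)) :=
  (((((S.tendsto_energyBound T G u₀ v₀ hε).const_mul _).add_const _).add_const _).add_const
    _).add_const _

theorem constLp_clm (c : V) (A : V →L[ℝ] H) :
    A.compLpL 2 (ivl 0 T) (constLp T c) = constLp T (A c) := by
  refine Lp.ext ?_
  filter_upwards [A.coeFn_compLpL (p := 2) (constLp T c), coeFn_constLp T c,
    coeFn_constLp T (A c)] with t h1 h2 h3
  rw [h1, h2, h3]

theorem integral_norm_sq_le {f : ℝ → V} (hf : Continuous f) (hT : 0 ≤ T) :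
    ∫ t in (0 : ℝ)..T, ‖f t‖ ^ 2 ≤ S.K * ∫ t in (0 : ℝ)..T, ‖S.D (f t)‖ ^ 2 := by
  rw [← intervalIntegral.integral_const_mul]
  exact intervalIntegral.integral_mono_on hT (Continuous.intervalIntegrable (by fun_prop) _ _)
    (Continuous.intervalIntegrable (by fun_prop) _ _) fun t _ => S.norm_sq_le _

theorem exists_isSolution (hT : 0 ≤ T) (hK : 0 ≤ S.K) (dg : Lp ℝ 2 (ivl 0 T)) (u₀ v₀ : V) {δ : ℝ}
    (hδ : 0 < δ) : ∃ u w z, S.IsSolution hT (primL hT dg) u₀ v₀ u w z ∧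
      (∀ᵐ t ∂(ivl 0 T), ‖S.D (u t)‖ ^ 2
        ≤ 2 / S.r₀ * (S.energyBound 0 T ‖dg‖ u₀ v₀ * Real.exp T)) ∧
      ‖u‖ ^ 2 ≤ S.K * (2 / S.r₀ * (S.energyBound 0 T ‖dg‖ u₀ v₀ * (Real.exp T - 1))) ∧
      ‖w‖ ^ 2 ≤ S.K * (1 / (2 * S.κ₀) * (S.energyBound 0 T ‖dg‖ u₀ v₀ * Real.exp T)) ∧
      ‖z‖ ^ 2 ≤ 1 / (2 * S.ρ₀) * S.accelerationBound 0 T ‖dg‖ δ u₀ v₀ := by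
  let ε : ℕ → ℝ := fun n => 1 / ((n : ℝ) + 1)
  have hε : ∀ n, 0 < ε n := fun n => by positivity
  let 𝓤 : Ultrafilter ℕ := hyperfilter ℕ
  have hε0 : Tendsto ε 𝓤 (𝓝 0) :=
    tendsto_one_div_add_atTop_nhds_zero_nat.mono_left Nat.hyperfilter_le_atTop
  have hε0' : Tendsto ε atTop (𝓝 0) := tendsto_one_div_add_atTop_nhds_zero_nat
  choose u w z h using fun n => S.exists_isRegularized (hε n)
    (continuous_prim (Lp.integrable_ivl dg)) u₀ v₀
  have hr := S.r₀_pos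
  have hκ := S.κ₀_pos
  have hρ := S.ρ₀_pos
  have hTT : T ∈ Icc 0 T := right_mem_Icc.2 hT
  let R : ℕ → ℝ := fun n => S.energyBound (ε n) T ‖dg‖ u₀ v₀
  let Q : ℕ → ℝ := fun n => S.accelerationBound (ε n) T ‖dg‖ δ u₀ v₀
  have hR0 : ∀ n, 0 ≤ R n := fun n => (h n).energyBound_nonneg (hε n).le hT
  have hR := S.tendsto_energyBound T ‖dg‖ u₀ v₀ hε0
  have hQ := S.tendsto_accelerationBound T ‖dg‖ δ u₀ v₀ hε0
  let U : ℕ → Lp V 2 (ivl 0 T) := fun n => (memLp_of_continuous (h n).continuous_u T).toLp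
  let W : ℕ → Lp V 2 (ivl 0 T) := fun n => (memLp_of_continuous (h n).continuous_w T).toLp
  let Z : ℕ → Lp V 2 (ivl 0 T) := fun n => (memLp_of_continuous (h n).continuous_z T).toLp
  have hD : ∀ n, ∀ t ∈ Icc 0 T, ‖S.D (u n t)‖ ^ 2 ≤ 2 / S.r₀ * (R n * Real.exp T) := by
    intro n t ht
    have h1 := (h n).energy_le_exp (hε n).le ht
    have h2 : 0 ≤ 2 * S.κ₀ * ∫ s in (0 : ℝ)..t, ‖S.D (w n s)‖ ^ 2 :=
      mul_nonneg (by positivity) (intervalIntegral.integral_nonneg ht.1 fun s _ => sq_nonneg _)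
    have h3 := mul_le_mul_of_nonneg_left (Real.exp_le_exp.2 ht.2) (hR0 n)
    rw [div_mul_eq_mul_div, le_div_iff₀ hr]
    change _ ≤ R n * _ at h1
    linarith
  have hU : ∀ n, ‖U n‖ ^ 2 ≤ S.K * (2 / S.r₀ * (R n * (Real.exp T - 1))) := by
    intro n
    rw [norm_sq_toLp (h n).continuous_u hT]
    refine (S.integral_norm_sq_le (h n).continuous_u hT).trans (mul_le_mul_of_nonneg_left ?_ hK)
    have := (h n).integral_norm_D_u_le (hε n).le hTT
    rw [div_mul_eq_mul_div, le_div_iff₀ hr]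
    change _ ≤ R n * _ at this
    linarith
  have hW : ∀ n, ‖W n‖ ^ 2 ≤ S.K * (1 / (2 * S.κ₀) * (R n * Real.exp T)) := by
    intro n
    rw [norm_sq_toLp (h n).continuous_w hT]
    refine (S.integral_norm_sq_le (h n).continuous_w hT).trans (mul_le_mul_of_nonneg_left ?_ hK)
    have := (h n).energy_le_exp (hε n).le hTT
    have h2 := mul_nonneg (half_pos hr).le (sq_nonneg ‖S.D (u n T)‖)
    rw [div_mul_eq_mul_div, le_div_iff₀ (by positivity)]
    change _ ≤ R n * _ at this
    linarith
  have hJ : ∀ n, ‖S.j.compLpL 2 (ivl 0 T) (Z n)‖ ^ 2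
      = ∫ s in (0 : ℝ)..T, ‖S.j (z n s)‖ ^ 2 := by
    intro n
    have : S.j.compLpL 2 (ivl 0 T) (Z n)
        = (memLp_of_continuous (S.j.continuous.comp (h n).continuous_z) T).toLp := by
      refine Lp.ext ?_
      filter_upwards [S.j.coeFn_compLpL (p := 2) (Z n),
        (memLp_of_continuous (h n).continuous_z T).coeFn_toLp,
        (memLp_of_continuous (S.j.continuous.comp (h n).continuous_z) T).coeFn_toLp]
        with t h1 h2 h3
      rw [h1, h2, h3, Function.comp_apply]
    rw [this, norm_sq_toLp (S.j.continuous.comp (h n).continuous_z) hT]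
    rfl
  have hacc := fun n => (h n).integral_acceleration_le (hε n).le hT hδ
  have hZ : ∀ n, ‖S.j.compLpL 2 (ivl 0 T) (Z n)‖ ^ 2 ≤ 1 / (2 * S.ρ₀) * Q n := by
    intro n
    have h1 : 0 ≤ 2 * ε n * ∫ s in (0 : ℝ)..T, ‖z n s‖ ^ 2 :=
      mul_nonneg (mul_nonneg zero_le_two (hε n).le)
        (intervalIntegral.integral_nonneg hT fun s _ => sq_nonneg _)
    rw [hJ, div_mul_eq_mul_div, le_div_iff₀ (by positivity)]
    have := hacc n
    change _ ≤ Q n at this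
    linarith
  -- The acceleration estimate bounds `ε ‖z‖²`, and `‖ε z‖²` carries one more factor `ε`.
  have hεZ : ∀ n, ‖ε n • Z n‖ ^ 2 ≤ ε n * (Q n / 2) := by
    intro n
    have h1 : 0 ≤ 2 * S.ρ₀ * ∫ s in (0 : ℝ)..T, ‖S.j (z n s)‖ ^ 2 :=
      mul_nonneg (by positivity) (intervalIntegral.integral_nonneg hT fun s _ => sq_nonneg _)
    have h2 : ‖Z n‖ ^ 2 = ∫ s in (0 : ℝ)..T, ‖z n s‖ ^ 2 :=
      norm_sq_toLp (h n).continuous_z hT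
    have h3 := hacc n
    change _ ≤ Q n at h3
    rw [norm_smul, mul_pow, Real.norm_eq_abs, sq_abs, h2, sq, mul_assoc]
    exact mul_le_mul_of_nonneg_left (by linarith) (hε n).le
  have hεZ0 : Tendsto (fun n => ε n • Z n) 𝓤 (𝓝 0) := by
    rw [tendsto_zero_iff_norm_tendsto_zero]
    have h1 : Tendsto (fun n => ε n * (Q n / 2)) 𝓤 (𝓝 0) := by
      simpa using hε0.mul (hQ.div_const 2)
    have h2 : Tendsto (fun n => ‖ε n • Z n‖ ^ 2) 𝓤 (𝓝 0) :=
      squeeze_zero (fun n => sq_nonneg _) hεZ h1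
    simpa [Real.sqrt_sq] using h2.sqrt
  -- Convergence along `atTop`, rather than along the ultrafilter, is what bounds the sequences for
  -- all `n`.
  have hR' := S.tendsto_energyBound T ‖dg‖ u₀ v₀ hε0'
  obtain ⟨C₁, hC₁⟩ := exists_norm_le_of_norm_sq_le hW (((hR'.mul_const _).const_mul _).const_mul _)
  obtain ⟨C₂, hC₂⟩ := exists_norm_le_of_norm_sq_le hZ
    ((S.tendsto_accelerationBound T ‖dg‖ δ u₀ v₀ hε0').const_mul _)
  obtain ⟨W', hW'⟩ := exists_weakTendsto hC₁ 𝓤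
  obtain ⟨Z', hZ'⟩ := exists_weakTendsto hC₂ 𝓤
  have eU : ∀ n, U n = constLp T u₀ + primL hT (W n) := fun n => by
    have := toLp_eq_constLp_add_primL (h n).hasDerivAt_u (h n).continuous_u (h n).continuous_w hT
    rwa [(h n).u_zero] at this
  have eW : ∀ n, S.j.compLpL 2 (ivl 0 T) (W n)
      = constLp T (S.j v₀) + primL hT (S.j.compLpL 2 (ivl 0 T) (Z n)) := fun n => by
    have := toLp_eq_constLp_add_primL (h n).hasDerivAt_w (h n).continuous_w (h n).continuous_z hT
    rw [(h n).w_zero] at this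
    rw [← compLpL_primL, ← constLp_clm, ← map_add]
    exact congrArg _ this
  have hU' : WeakTendsto U 𝓤 (constLp T u₀ + primL hT W') := by
    rw [show U = fun n => constLp T u₀ + primL hT (W n) from funext eU]
    exact (WeakTendsto.of_tendsto tendsto_const_nhds).add (hW'.map _)
  refine ⟨_, W', Z', ⟨rfl, ?_, fun v => S.lhs_eq_iff.1 ?_⟩, ?_,
    hU'.norm_sq_le (((hR.mul_const _).const_mul _).const_mul _) hU,
    hW'.norm_sq_le (((hR.mul_const _).const_mul _).const_mul _) hW,
    hZ'.norm_sq_le (hQ.const_mul _) hZ⟩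
  · refine (hW'.map (S.j.compLpL 2 (ivl 0 T))).unique ?_
    simp only [eW]
    exact (WeakTendsto.of_tendsto tendsto_const_nhds).add (hZ'.map _)
  · have h1 := (weakTendsto_lhs S v hU' hW' hZ').add
      ((WeakTendsto.of_tendsto hεZ0).map ((innerSL ℝ v).compLpL 2 (ivl 0 T)))
    rw [map_zero, add_zero] at h1
    refine h1.unique ?_
    simp only [fun n => (h n).lhs_add hT v, U, W, Z]
    exact WeakTendsto.of_tendsto tendsto_const_nhds
  · have hae : constLp T u₀ + primL hT W' =ᵐ[ivl 0 T] fun t => u₀ + prim T W' t :=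
      (eq_constLp_add_primL_iff hT).1 rfl
    filter_upwards [hae, ae_restrict_mem measurableSet_Ioo]
      with t h1 h2
    rw [h1]
    -- Evaluation of the primitive at `t` is a bounded operator, so `u n t` converges weakly in `V`
    -- at each such `t` and the pointwise bound passes to the limit.
    have h3 : WeakTendsto (fun n => S.D (u₀ + primEval hT h2.1.le (W n))) 𝓤
        (S.D (u₀ + primEval hT h2.1.le W')) :=
      ((WeakTendsto.of_tendsto tendsto_const_nhds).add (hW'.map _)).map _
    refine h3.norm_sq_le ((hR.mul_const _).const_mul _) fun n => ?_
    refine le_of_eq_of_le ?_ (hD n t ⟨h2.1.le, h2.2.le⟩)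
    rw [primEval_apply, prim_congr (memLp_of_continuous (h n).continuous_w T).coeFn_toLp,
      prim_eq_intervalIntegral ⟨h2.1.le, h2.2.le⟩,
      intervalIntegral.integral_eq_sub_of_hasDerivAt (fun s _ => (h n).hasDerivAt_u s)
        ((h n).continuous_w.intervalIntegrable _ _), (h n).u_zero, add_sub_cancel]

end DampedSystem

/-! ### Uniqueness for the abstract equation. -/

namespace DampedSystem

variable {V H : Type*} [NormedAddCommGroup V] [InnerProductSpace ℝ V] [CompleteSpace V]
  [NormedAddCommGroup H] [InnerProductSpace ℝ H] [CompleteSpace H] {S : DampedSystem V H} {T : ℝ}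

theorem prim_compLpL {X Y : Type*} [NormedAddCommGroup X] [NormedSpace ℝ X] [CompleteSpace X]
    [NormedAddCommGroup Y] [NormedSpace ℝ Y] [CompleteSpace Y] (A : X →L[ℝ] Y)
    (f : Lp X 2 (ivl 0 T)) (t : ℝ) :
    prim T (A.compLpL 2 (ivl 0 T) f : ℝ → Y) t = A (prim T f t) := by
  rw [prim_congr (A.coeFn_compLpL (p := 2) f), prim_clm (Lp.integrable_ivl f)]

/-- The exceptional null set of the equation depends on `v`. After integration in time the identity
holds for all `t` and `v`, so `v` may be chosen depending on `t`. -/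
theorem IsSolution.integrated_equation {hT : 0 ≤ T} {u₀ v₀ : V} {u w : Lp V 2 (ivl 0 T)}
    {z : Lp H 2 (ivl 0 T)} (h : S.IsSolution hT 0 u₀ v₀ u w z) (v : V) {t : ℝ} (ht : 0 ≤ t) :
    ⟪S.ρ (prim T z t), S.j v⟫_ℝ + ⟪S.μ (S.j (prim T w t)), S.j v⟫_ℝ
      + ⟪S.r (S.D (prim T u t)), S.D v⟫_ℝ + ⟪S.κ (S.D (prim T w t)), S.D v⟫_ℝ = 0 := by
  have h1 : S.lhs v u w z = S.β v • 0 := S.lhs_eq_iff.2 (h.equation v)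
  rw [smul_zero] at h1
  have h2 := congrArg (primEval hT ht) h1
  rw [lhs, map_add, map_add, map_add, map_zero] at h2
  simp only [primEval_apply, prim_compLpL, ContinuousLinearMap.comp_apply,
    innerSL_apply_apply] at h2
  rw [S.ρ_comm, S.μ_comm, S.r_comm, S.κ_comm, real_inner_comm (S.ρ _), real_inner_comm (S.μ _),
    real_inner_comm (S.r _), real_inner_comm (S.κ _)] at h2
  exact h2

theorem IsSolution.eq_zero {hT : 0 ≤ T} {u w : Lp V 2 (ivl 0 T)} {z : Lp H 2 (ivl 0 T)}
    (h : S.IsSolution hT 0 0 0 u w z) : u = 0 := by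
  set U : ℝ → V := prim T w with hU
  have hUc : Continuous U := continuous_prim (Lp.integrable_ivl w)
  have hu : u =ᵐ[ivl 0 T] U := by
    simpa using (eq_constLp_add_primL_iff hT).1 h.u_eq
  have hw : S.j.compLpL 2 (ivl 0 T) w =ᵐ[ivl 0 T] prim T z := by
    have := h.w_eq
    rw [map_zero] at this
    simpa using (eq_constLp_add_primL_iff hT).1 this
  have hzc : Continuous (prim T (z : ℝ → H)) := continuous_prim (Lp.integrable_ivl z)
  have hjU : (fun t => S.j (U t)) = prim T (prim T z) := by
    funext t
    rw [hU, ← prim_compLpL, prim_congr hw]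
  set Y : ℝ → V := fun t => ∫ s in (0 : ℝ)..t, U s with hY
  have hYd : ∀ t, HasDerivAt Y (U t) t := fun t =>
    intervalIntegral.integral_hasDerivAt_right (hUc.intervalIntegrable 0 t)
      (hUc.stronglyMeasurableAtFilter _ _) hUc.continuousAt
  have hYc : Continuous Y := continuous_iff_continuousAt.2 fun t => (hYd t).continuousAt
  have hYu : ∀ t ∈ Icc 0 T, prim T u t = Y t := fun t ht => by
    rw [prim_congr hu, prim_eq_intervalIntegral ht]
  -- With `U` representing `u` and `Y = ∫ U`, testing the integrated equation with `U t` gives `φ' =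
  -- -2⟪μ j U, j U⟫ - 2⟪κ D U, D U⟫ ≤ 0`, while `φ 0 = 0`.
  let φ : ℝ → ℝ := fun t => ⟪S.ρ (S.j (U t)), S.j (U t)⟫_ℝ + ⟪S.r (S.D (Y t)), S.D (Y t)⟫_ℝ
  have hφ : ∀ t ∈ Ioo 0 T, HasDerivAt φ
      (2 * ⟪S.ρ (S.j (U t)), prim T z t⟫_ℝ + 2 * ⟪S.r (S.D (Y t)), S.D (U t)⟫_ℝ) t := by
    intro t ht
    have h1 : HasDerivAt (fun t => S.j (U t)) (prim T z t) t := by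
      rw [hjU]; exact hasDerivAt_prim hzc ht
    exact (hasDerivAt_inner_clm S.ρ S.ρ_comm (ContinuousLinearMap.id ℝ H) h1).add
      (hasDerivAt_inner_clm S.r S.r_comm S.D (hYd t))
  have hanti : AntitoneOn φ (Icc 0 T) := by
    refine antitoneOn_of_deriv_nonpos (convex_Icc 0 T) (by fun_prop) (fun t ht => ?_)
      fun t ht => ?_ <;> rw [interior_Icc] at ht
    · exact (hφ t ht).differentiableAt.differentiableWithinAt
    · rw [(hφ t ht).deriv]
      have h1 := h.integrated_equation (U t) ht.1.le
      rw [hYu t ⟨ht.1.le, ht.2.le⟩, S.ρ_comm, real_inner_comm] at h1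
      have h2 := S.le_κ (S.D (U t))
      have h3 := mul_nonneg S.κ₀_pos.le (sq_nonneg ‖S.D (U t)‖)
      linarith [S.le_μ (S.j (U t))]
  have hU0 : ∀ t ∈ Icc 0 T, U t = 0 := fun t ht => by
    have h1 : φ t ≤ φ 0 := hanti (left_mem_Icc.2 hT) ht ht.1
    have h2 : φ 0 = 0 := by simp [φ, hU, hY]
    have h3 := S.le_ρ (S.j (U t))
    have h4 := S.le_r (S.D (Y t))
    have h5 := mul_nonneg S.r₀_pos.le (sq_nonneg ‖S.D (Y t)‖)
    have h6 : S.ρ₀ * ‖S.j (U t)‖ ^ 2 ≤ 0 := by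
      simp only [φ] at h1 h2
      linarith
    have h7 : ‖S.j (U t)‖ = 0 := by
      have := nonpos_of_mul_nonpos_right h6 S.ρ₀_pos
      exact pow_eq_zero_iff two_ne_zero |>.1 (le_antisymm this (sq_nonneg _))
    exact S.j_injective (by rw [norm_eq_zero.1 h7, map_zero])
  refine Lp.ext ?_
  filter_upwards [hu, Lp.coeFn_zero V 2 (ivl 0 T), ae_restrict_mem measurableSet_Ioo]
    with t h1 h2 h3
  rw [h1, h2, hU0 t ⟨h3.1.le, h3.2.le⟩, Pi.zero_apply]

theorem IsSolution.sub {hT : 0 ≤ T} {g : Lp ℝ 2 (ivl 0 T)} {u₀ v₀ : V}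
    {u w u' w' : Lp V 2 (ivl 0 T)} {z z' : Lp H 2 (ivl 0 T)} (h : S.IsSolution hT g u₀ v₀ u w z)
    (h' : S.IsSolution hT g u₀ v₀ u' w' z') :
    S.IsSolution hT 0 0 0 (u - u') (w - w') (z - z') where
  u_eq := by
    rw [h.u_eq, h'.u_eq, map_sub, add_sub_add_left_eq_sub]
    simp [constLp]
  w_eq := by
    rw [map_sub, h.w_eq, h'.w_eq, map_sub, add_sub_add_left_eq_sub]
    simp [constLp]
  equation v := by
    refine S.lhs_eq_iff.1 ?_
    have e1 := S.lhs_eq_iff.2 (h.equation v)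
    have e2 := S.lhs_eq_iff.2 (h'.equation v)
    have : S.lhs v (u - u') (w - w') (z - z') = S.lhs v u w z - S.lhs v u' w' z' := by
      simp only [lhs, map_sub]
      abel
    rw [this, e1, e2, sub_self, smul_zero]

theorem IsSolution.unique {hT : 0 ≤ T} {g : Lp ℝ 2 (ivl 0 T)} {u₀ v₀ : V}
    {u w u' w' : Lp V 2 (ivl 0 T)} {z z' : Lp H 2 (ivl 0 T)} (h : S.IsSolution hT g u₀ v₀ u w z)
    (h' : S.IsSolution hT g u₀ v₀ u' w' z') : u = u' :=
  sub_eq_zero.1 (h.sub h').eq_zero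

end DampedSystem

/-! ### The beam as an abstract damped system. -/

section Beam

variable {ℓ T : ℝ} {ρ μ r κ : ℝ → ℝ} {ρ₀ ρ₁ μ₀ μ₁ r₀ r₁ κ₀ κ₁ : ℝ}

theorem inner_mulL_le {a : ℝ → ℝ} {C : ℝ} (ha : AEStronglyMeasurable a (ivl 0 ℓ))
    (hC : ∀ᵐ x ∂(ivl 0 ℓ), |a x| ≤ C) (f : L2 ℓ) : ⟪mulL ha hC f, f⟫_ℝ ≤ C * ‖f‖ ^ 2 := by
  have := mul_le_mul_of_nonneg_right (norm_mulL_le ha hC f) (norm_nonneg f)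
  nlinarith [real_inner_le_norm (mulL ha hC f) f]

theorem ae_abs_le_of_nonneg_le {a : ℝ → ℝ} {c C : ℝ} (hc : 0 ≤ c)
    (h : ∀ᵐ x ∂(ivl 0 ℓ), c ≤ a x ∧ a x ≤ C) : ∀ᵐ x ∂(ivl 0 ℓ), |a x| ≤ C :=
  h.mono fun _ hx => (abs_of_nonneg (hc.trans hx.1)).trans_le hx.2

theorem nonneg_of_ae_le (hℓ : 0 < ℓ) {a : ℝ → ℝ} {c C : ℝ} (hc : 0 ≤ c)
    (h : ∀ᵐ x ∂(ivl 0 ℓ), c ≤ a x ∧ a x ≤ C) : 0 ≤ C := by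
  have : NeBot (ae (ivl 0 ℓ)) := by
    rw [ae_neBot, ne_eq, Measure.restrict_eq_zero, Real.volume_Ioo]
    simpa using hℓ
  obtain ⟨x, hx⟩ := h.exists
  exact hc.trans (hx.1.trans hx.2)

/-- The damped cantilever beam as an abstract damped system. -/
def beamSystem (hℓ : 0 < ℓ)
    (hρ : AEStronglyMeasurable ρ (ivl 0 ℓ)) (hμ : AEStronglyMeasurable μ (ivl 0 ℓ))
    (hr : AEStronglyMeasurable r (ivl 0 ℓ)) (hκ : AEStronglyMeasurable κ (ivl 0 ℓ))
    (hρ₀ : 0 < ρ₀) (hρb : ∀ᵐ x ∂(ivl 0 ℓ), ρ₀ ≤ ρ x ∧ ρ x ≤ ρ₁)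
    (hr₀ : 0 < r₀) (hrb : ∀ᵐ x ∂(ivl 0 ℓ), r₀ ≤ r x ∧ r x ≤ r₁)
    (hμ₀ : 0 ≤ μ₀) (hμb : ∀ᵐ x ∂(ivl 0 ℓ), μ₀ ≤ μ x ∧ μ x ≤ μ₁)
    (hκ₀ : 0 < κ₀) (hκb : ∀ᵐ x ∂(ivl 0 ℓ), κ₀ ≤ κ x ∧ κ x ≤ κ₁) :
    DampedSystem (V ℓ) (L2 ℓ) where
  j := fnL ℓ
  D := dxxL ℓ
  β := tip hℓ
  ρ := mulL hρ (ae_abs_le_of_nonneg_le hρ₀.le hρb)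
  μ := mulL hμ (ae_abs_le_of_nonneg_le hμ₀ hμb)
  r := mulL hr (ae_abs_le_of_nonneg_le hr₀.le hrb)
  κ := mulL hκ (ae_abs_le_of_nonneg_le hκ₀.le hκb)
  ρ₀ := ρ₀
  ρ₁ := ρ₁
  μ₁ := μ₁
  r₀ := r₀
  r₁ := r₁
  κ₀ := κ₀
  κ₁ := κ₁
  L := ℓ ^ 3 / 3
  K := Cstar ℓ
  j_injective := fnL_injective ℓ
  norm_sq_le := V.norm_sq_le hℓ
  β_sq_le := tip_sq_le hℓ
  L_pos := by positivity
  ρ₀_pos := hρ₀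
  r₀_pos := hr₀
  κ₀_pos := hκ₀
  r₁_nonneg := nonneg_of_ae_le hℓ hr₀.le hrb
  ρ_comm := inner_mulL_comm _ _
  μ_comm := inner_mulL_comm _ _
  r_comm := inner_mulL_comm _ _
  κ_comm := inner_mulL_comm _ _
  le_ρ := le_inner_mulL _ _ (hρb.mono fun _ h => h.1)
  ρ_le := inner_mulL_le _ _
  le_μ x := (mul_nonneg hμ₀ (sq_nonneg ‖x‖)).trans
    (le_inner_mulL _ _ (hμb.mono fun _ h => h.1) x)
  μ_le := inner_mulL_le _ _
  le_r := le_inner_mulL _ _ (hrb.mono fun _ h => h.1)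
  norm_r_le := norm_mulL_le _ _
  le_κ := le_inner_mulL _ _ (hκb.mono fun _ h => h.1)
  κ_le := inner_mulL_le _ _

/-- The weak time derivative of `u` is taken in `L²(0, ℓ)`, while the abstract identity for `u`
lives in `V`. Injectivity of the inclusion and the `V`-valued initial condition bridge the two. -/
theorem isWeakSolutionWith_iff (hℓ : 0 < ℓ) (hT : 0 < T)
    (hρ : AEStronglyMeasurable ρ (ivl 0 ℓ)) (hμ : AEStronglyMeasurable μ (ivl 0 ℓ))
    (hr : AEStronglyMeasurable r (ivl 0 ℓ)) (hκ : AEStronglyMeasurable κ (ivl 0 ℓ))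
    (hρ₀ : 0 < ρ₀) (hρb : ∀ᵐ x ∂(ivl 0 ℓ), ρ₀ ≤ ρ x ∧ ρ x ≤ ρ₁)
    (hr₀ : 0 < r₀) (hrb : ∀ᵐ x ∂(ivl 0 ℓ), r₀ ≤ r x ∧ r x ≤ r₁)
    (hμ₀ : 0 ≤ μ₀) (hμb : ∀ᵐ x ∂(ivl 0 ℓ), μ₀ ≤ μ x ∧ μ x ≤ μ₁)
    (hκ₀ : 0 < κ₀) (hκb : ∀ᵐ x ∂(ivl 0 ℓ), κ₀ ≤ κ x ∧ κ x ≤ κ₁)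
    (g : Lp ℝ 2 (ivl 0 T)) (u₀ v₀ : V ℓ) (u ut : Lp (V ℓ) 2 (ivl 0 T))
    (utt : Lp (L2 ℓ) 2 (ivl 0 T)) :
    IsWeakSolutionWith ℓ T ρ μ r κ g u₀ v₀ u ut utt ↔
      (beamSystem hℓ hρ hμ hr hκ hρ₀ hρb hr₀ hrb hμ₀ hμb hκ₀ hκb).IsSolution hT.le g u₀ v₀
        u ut utt := by
  have := completeSpace_V hℓ
  have hu : MemLp (fun t => (u t).fn) 2 (ivl 0 T) := (fnL ℓ).comp_memLp u
  have hut : MemLp (fun t => (ut t).fn) 2 (ivl 0 T) := (fnL ℓ).comp_memLp ut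
  have hfn : ∀ t, u₀.fn + prim T (fun s => (ut s).fn) t = fnL ℓ (u₀ + prim T ut t) := fun t => by
    rw [map_add, ← prim_clm (Lp.integrable_ivl ut)]
    rfl
  have e1 : u = constLp T u₀ + primL hT.le ut ↔ (HasWeakDeriv 0 T (fun t => (u t).fn)
      fun t => (ut t).fn) ∧ HasValueAt 0 T (fun t => u t) 0 u₀ := by
    rw [eq_constLp_add_primL_iff]
    constructor
    · intro h
      refine ⟨((hasWeakDeriv_and_hasValueAt_iff (c := u₀.fn) hT hu hut).2 ?_).1,
        ((hasWeakDeriv_and_hasValueAt_iff hT (Lp.memLp u) (Lp.memLp ut)).2 h).2⟩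
      filter_upwards [h] with t ht
      rw [hfn, ← ht]
      rfl
    · rintro ⟨h1, w, ⟨w1, w2⟩, w3⟩
      have h2 : HasValueAt 0 T (fun t => (u t).fn) 0 u₀.fn :=
        ⟨fun t => fnL ℓ (w t), ⟨(fnL ℓ).continuous.comp_continuousOn w1,
          w2.mono fun t ht => congrArg (fnL ℓ) ht⟩, congrArg (fnL ℓ) w3⟩
      filter_upwards [(hasWeakDeriv_and_hasValueAt_iff hT hu hut).1 ⟨h1, h2⟩] with t ht
      rw [hfn] at ht
      exact fnL_injective ℓ ht
  have e2 : (fnL ℓ).compLpL 2 (ivl 0 T) ut = constLp T v₀.fn + primL hT.le utt ↔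
      (HasWeakDeriv 0 T (fun t => (ut t).fn) fun t => utt t) ∧
        HasValueAt 0 T (fun t => (ut t).fn) 0 v₀.fn := by
    rw [eq_constLp_add_primL_iff, hasWeakDeriv_and_hasValueAt_iff hT hut (Lp.memLp utt)]
    have h := (fnL ℓ).coeFn_compLpL (p := 2) ut
    exact ⟨fun h' => h.symm.trans h', fun h' => h.trans h'⟩
  have e3 : ∀ v : V ℓ, (∀ᵐ t ∂(ivl 0 T),
      (∫ x, ρ x * (utt t) x * v.fn x ∂(ivl 0 ℓ)) + (∫ x, μ x * (ut t).fn x * v.fn x ∂(ivl 0 ℓ))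
      + (∫ x, r x * (u t).dxx x * v.dxx x ∂(ivl 0 ℓ))
      + (∫ x, κ x * (ut t).dxx x * v.dxx x ∂(ivl 0 ℓ)) = g t * v.rep ℓ) ↔
      ∀ᵐ t ∂(ivl 0 T), ⟪mulL hρ (ae_abs_le_of_nonneg_le hρ₀.le hρb) (utt t), fnL ℓ v⟫_ℝ
        + ⟪mulL hμ (ae_abs_le_of_nonneg_le hμ₀ hμb) (fnL ℓ (ut t)), fnL ℓ v⟫_ℝ
        + ⟪mulL hr (ae_abs_le_of_nonneg_le hr₀.le hrb) (dxxL ℓ (u t)), dxxL ℓ v⟫_ℝ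
        + ⟪mulL hκ (ae_abs_le_of_nonneg_le hκ₀.le hκb) (dxxL ℓ (ut t)), dxxL ℓ v⟫_ℝ
        = g t * tip hℓ v := fun v => by
    simp only [inner_mulL, rep_eq_tip hℓ, fnL_apply, dxxL_apply]
  constructor
  · rintro ⟨h1, h2, h3, h4, h5⟩
    exact ⟨e1.2 ⟨h1, h4⟩, e2.2 ⟨h2, h5⟩, fun v => (e3 v).1 (h3 v)⟩
  · rintro ⟨h1, h2, h3⟩
    exact ⟨(e1.1 h1).1, (e2.1 h2).1, fun v => (e3 v).2 (h3 v), (e1.1 h1).2, (e2.1 h2).2⟩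

/-- The coefficients of `G²`, `a²`, `b²`, `c²` are compared one by one with the four entries of the
maximum. The slack lies in the factor `(ℓ³ + 3)/3 ≥ 1` inside `A` and in the surplus `2T/κ₀ · G²`.
-/
theorem acceleration_constant_le (hℓ : 0 < ℓ) (hT : 0 < T) (hr₀ : 0 < r₀) (hκ₀ : 0 < κ₀)
    (hρ₁ : 0 ≤ ρ₁) (hr₁ : 0 ≤ r₁) (G a b c : ℝ) :
    (4 * r₁ ^ 2 / r₀ + r₁ + κ₀ * ℓ ^ 3 / (4 * (ℓ ^ 3 + 3))) * (Real.exp T / κ₀)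
        * (2 * (1 + T) * (ℓ ^ 3 / 3) / r₀ * G ^ 2 + ρ₁ * a ^ 2 + r₁ * b ^ 2)
      + (2 * (ℓ ^ 3 / 3) * T / κ₀
        + ℓ ^ 3 / 3 / (2 * (κ₀ * ℓ ^ 3 / (4 * (ℓ ^ 3 + 3))))) * G ^ 2
      + μ₁ * a ^ 2 + (κ₁ + 1) * c ^ 2 + r₁ ^ 2 * b ^ 2
    ≤ C1sq ℓ T ρ₁ μ₁ r₀ r₁ κ₀ κ₁ * ((1 + T) * ℓ ^ 3 * G ^ 2 + (a ^ 2 + b ^ 2 + c ^ 2)) := by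
  have hq : 0 < ℓ ^ 3 := by positivity
  set q := ℓ ^ 3 with hq'
  set A := constA ℓ T r₀ r₁ κ₀ with hA
  have hAle : (4 * r₁ ^ 2 / r₀ + r₁ + κ₀ * q / (4 * (q + 3))) * (Real.exp T / κ₀) ≤ A := by
    rw [hA, constA, C0sq, sub_add_cancel, ← hq']
    refine mul_le_mul_of_nonneg_right ?_ (by positivity)
    have : 4 * r₁ ^ 2 * (q + 3) / (3 * r₀) = 4 * r₁ ^ 2 / r₀ + 4 * r₁ ^ 2 * q / (3 * r₀) := by
      field_simp; ring
    rw [this]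
    have : 0 ≤ 4 * r₁ ^ 2 * q / (3 * r₀) := by positivity
    linarith
  set C := C1sq ℓ T ρ₁ μ₁ r₀ r₁ κ₀ κ₁ with hC
  have m1 : A * (2 / (3 * r₀)) + 2 * (q + 3) / (3 * q * κ₀) ≤ C :=
    (le_max_left _ _).trans (le_max_left _ _)
  have m2 : A * ρ₁ + μ₁ ≤ C := (le_max_right _ _).trans (le_max_left _ _)
  have m3 : A * r₁ + r₁ ^ 2 ≤ C := (le_max_left _ _).trans (le_max_right _ _)
  have m4 : κ₁ + 1 ≤ C := (le_max_right _ _).trans (le_max_right _ _)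
  have hR : 0 ≤ 2 * (1 + T) * (q / 3) / r₀ * G ^ 2 + ρ₁ * a ^ 2 + r₁ * b ^ 2 := by positivity
  have s1 := mul_le_mul_of_nonneg_right hAle hR
  have n1 := mul_le_mul_of_nonneg_right m1 (show 0 ≤ (1 + T) * q * G ^ 2 by positivity)
  have n2 := mul_le_mul_of_nonneg_right m2 (sq_nonneg a)
  have n3 := mul_le_mul_of_nonneg_right m3 (sq_nonneg b)
  have n4 := mul_le_mul_of_nonneg_right m4 (sq_nonneg c)
  have k1 : (A * (2 / (3 * r₀)) + 2 * (q + 3) / (3 * q * κ₀)) * ((1 + T) * q * G ^ 2)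
      = A * (2 * (1 + T) * (q / 3) / r₀ * G ^ 2) + (2 * (q / 3) * T / κ₀
        + q / 3 / (2 * (κ₀ * q / (4 * (q + 3))))) * G ^ 2 + 2 * T / κ₀ * G ^ 2 := by
    field_simp
    ring
  have k2 : 0 ≤ 2 * T / κ₀ * G ^ 2 := by positivity
  linarith

end Beam

end KVBeam

end

/-! ### The theorem for the cantilever. -/

open KVBeam in
theorem theorem2p1 (ℓ T : ℝ) (hℓ : 0 < ℓ) (hT : 0 < T)
    (ρ μ r κ : ℝ → ℝ) (ρ₀ ρ₁ μ₀ μ₁ r₀ r₁ κ₀ κ₁ : ℝ)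
    (hρ : MemLp ρ ∞ (ivl 0 ℓ)) (hμ : MemLp μ ∞ (ivl 0 ℓ)) (hr : IsH2 ℓ r) (hκ : IsH2 ℓ κ)
    (hρ₀ : 0 < ρ₀) (hρb : ∀ᵐ x ∂(ivl 0 ℓ), ρ₀ ≤ ρ x ∧ ρ x ≤ ρ₁)
    (hr₀ : 0 < r₀) (hrb : ∀ᵐ x ∂(ivl 0 ℓ), r₀ ≤ r x ∧ r x ≤ r₁)
    (hμ₀ : 0 ≤ μ₀) (hμb : ∀ᵐ x ∂(ivl 0 ℓ), μ₀ ≤ μ x ∧ μ x ≤ μ₁)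
    (hκ₀ : 0 < κ₀) (hκb : ∀ᵐ x ∂(ivl 0 ℓ), κ₀ ≤ κ x ∧ κ x ≤ κ₁)
    (g dg : Lp ℝ 2 (ivl 0 T)) (hg : HasWeakDeriv 0 T (g : ℝ → ℝ) (dg : ℝ → ℝ))
    (hg0 : HasValueAt 0 T (g : ℝ → ℝ) 0 0)
    (u₀ v₀ : V ℓ) :
    (∃! u : Lp (V ℓ) 2 (ivl 0 T), IsWeakSolution ℓ T ρ μ r κ g u₀ v₀ u) ∧
    ∀ (u ut : Lp (V ℓ) 2 (ivl 0 T)) (utt : Lp (L2 ℓ) 2 (ivl 0 T)),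
      IsWeakSolutionWith ℓ T ρ μ r κ g u₀ v₀ u ut utt →
      eLpNorm (fun t => (u t).dxx) ∞ (ivl 0 T) ^ 2 ≤ ENNReal.ofReal
          (2 * (C0sq T + 1) / r₀ *
            (2 * (1 + T) * ℓ ^ 3 / (3 * r₀) * ‖dg‖ ^ 2 + R0 ρ₁ r₁ u₀ v₀)) ∧
      ‖u‖ ^ 2 ≤ 2 * Cstar ℓ * C0sq T / r₀ *
          (2 * (1 + T) * ℓ ^ 3 / (3 * r₀) * ‖dg‖ ^ 2 + R0 ρ₁ r₁ u₀ v₀) ∧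
      ‖ut‖ ^ 2 ≤ Cstar ℓ * (C0sq T + 1) / (2 * κ₀) *
          (2 * (1 + T) * ℓ ^ 3 / (3 * r₀) * ‖dg‖ ^ 2 + R0 ρ₁ r₁ u₀ v₀) ∧
      ‖utt‖ ^ 2 ≤ C1sq ℓ T ρ₁ μ₁ r₀ r₁ κ₀ κ₁ / (2 * ρ₀) *
          ((1 + T) * ℓ ^ 3 * ‖dg‖ ^ 2 + R1 u₀ v₀) := by
  have := completeSpace_V hℓ
  have hρ₁ : 0 ≤ ρ₁ := nonneg_of_ae_le hℓ hρ₀.le hρb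
  have hr₁ : 0 ≤ r₁ := nonneg_of_ae_le hℓ hr₀.le hrb
  have hiff := isWeakSolutionWith_iff hℓ hT hρ.1 hμ.1 hr.1.1 hκ.1.1 hρ₀ hρb hr₀ hrb hμ₀ hμb
    hκ₀ hκb g u₀ v₀
  set S := beamSystem hℓ hρ.1 hμ.1 hr.1.1 hκ.1.1 hρ₀ hρb hr₀ hrb hμ₀ hμb hκ₀ hκb with hS
  have hgeq : g = primL hT.le dg := by
    have h := (eq_constLp_add_primL_iff hT.le).2
      ((hasWeakDeriv_and_hasValueAt_iff hT (Lp.memLp g) (Lp.memLp dg)).1 ⟨hg, hg0⟩)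
    simpa [constLp] using h
  -- The free weight `δ` of the acceleration estimate is chosen as the middle summand of `A`; then
  -- `L/(2δ) = 2(ℓ³+3)/(3κ₀)`.
  have hδ : 0 < κ₀ * ℓ ^ 3 / (4 * (ℓ ^ 3 + 3)) := by positivity
  have hK : 0 ≤ S.K := by
    change 0 ≤ Cstar ℓ
    unfold Cstar
    positivity
  obtain ⟨u, ut, utt, hsol, b1, b2, b3, b4⟩ := S.exists_isSolution hT.le hK dg u₀ v₀ hδ
  rw [← hgeq] at hsol
  have hR : S.energyBound 0 T ‖dg‖ u₀ v₀
      = 2 * (1 + T) * ℓ ^ 3 / (3 * r₀) * ‖dg‖ ^ 2 + R0 ρ₁ r₁ u₀ v₀ := by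
    change 2 * (1 + T) * (ℓ ^ 3 / 3) / r₀ * ‖dg‖ ^ 2 + ρ₁ * ‖v₀.fn‖ ^ 2 + r₁ * ‖u₀.dxx‖ ^ 2
      + 0 * ‖v₀‖ ^ 2 = _
    rw [R0]
    field_simp
    ring
  refine ⟨⟨u, ⟨ut, utt, (hiff u ut utt).2 hsol⟩, ?_⟩, ?_⟩
  · rintro u' ⟨ut', utt', h'⟩
    exact ((hiff _ _ _).1 h').unique hsol
  intro u' ut' utt' h'
  -- An arbitrary solution equals the constructed one, and its weak time derivatives then agree as
  -- well, so the bounds of the construction apply to it.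
  obtain rfl : u' = u := ((hiff _ _ _).1 h').unique hsol
  have hweak := (hiff _ _ _).2 hsol
  obtain rfl : ut' = ut := by
    refine Lp.ext ?_
    filter_upwards [h'.deriv_one.unique hweak.deriv_one ((fnL ℓ).comp_memLp ut')
      ((fnL ℓ).comp_memLp ut)] with t ht
    exact fnL_injective ℓ ht
  obtain rfl : utt' = utt :=
    Lp.ext (h'.deriv_two.unique hweak.deriv_two (Lp.memLp _) (Lp.memLp _))
  rw [hR] at b1 b2 b3
  change ∀ᵐ t ∂(ivl 0 T), ‖(u' t).dxx‖ ^ 2 ≤ 2 / r₀ * _ at b1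
  change _ ≤ Cstar ℓ * (2 / r₀ * _) at b2
  change _ ≤ Cstar ℓ * (1 / (2 * κ₀) * _) at b3
  set R := 2 * (1 + T) * ℓ ^ 3 / (3 * r₀) * ‖dg‖ ^ 2 + R0 ρ₁ r₁ u₀ v₀ with hRdef
  have hR0 : 0 ≤ R := by
    rw [hRdef, R0]
    positivity
  refine ⟨?_, b2.trans_eq ?_, b3.trans_eq ?_, b4.trans ?_⟩
  · have hB : 0 ≤ 2 * (C0sq T + 1) / r₀ * R := by
      rw [C0sq, sub_add_cancel]
      positivity
    rw [eLpNorm_exponent_top, ← Real.sq_sqrt hB, ENNReal.ofReal_pow (Real.sqrt_nonneg _)]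
    refine pow_le_pow_left' (eLpNormEssSup_le_of_ae_bound ?_) 2
    filter_upwards [b1] with t ht
    refine Real.le_sqrt_of_sq_le (ht.trans_eq ?_)
    rw [C0sq]
    ring
  · rw [C0sq]
    ring
  · rw [C0sq]
    ring
  · rw [div_mul_eq_mul_div, one_mul, div_mul_eq_mul_div]
    change S.accelerationBound 0 T ‖dg‖ _ u₀ v₀ / (2 * ρ₀) ≤ _
    refine div_le_div_of_nonneg_right ?_ (by positivity)
    have h := acceleration_constant_le (μ₁ := μ₁) (κ₁ := κ₁) hℓ hT hr₀ hκ₀ hρ₁ hr₁ ‖dg‖ ‖v₀.fn‖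
      ‖u₀.dxx‖ ‖v₀.dxx‖
    refine le_of_eq_of_le ?_ h
    have e : S.energyBound 0 T ‖dg‖ u₀ v₀ = 2 * (1 + T) * (ℓ ^ 3 / 3) / r₀ * ‖dg‖ ^ 2
        + ρ₁ * ‖v₀.fn‖ ^ 2 + r₁ * ‖u₀.dxx‖ ^ 2 + 0 * ‖v₀‖ ^ 2 := rfl
    rw [zero_mul, add_zero] at e
    rw [← e]
    rfl
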